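/- Let $\mathfrak{sl}(3,\mathbb{C})$ be the Lie algebra of traceless complex $3\times 3$ matrices, with Chevalley basis $x_i,y_i$ ($1\le i\le 3$), $h_1,h_2$ determined by $$ah_1+bh_2+cx_1+dx_2+ex_3+c'y_1+d'y_2+e'y_3=\begin{pmatrix} a & c & -e\\ c' & b-a & d\\ -e' & d' & -b\end{pmatrix},$$ and let $\langle W_1,\dots,W_m\rangle$ denote the Lie subalgebra generated by $W_1,\dots,W_m$. Two subalgebras are called equivalent if some inner automorphism of $\mathfrak{sl}(3,\mathbb{C})$ maps one onto the other, where the inner automorphisms are the elements of the group generated by all $\exp(\operatorname{ad} x)$ with $\operatorname{ad} x$ nilpotent. Let $L_2$, $L_{3,a}$ ($a\in\mathbb{C}$), $L_4$, $L_5$ be the complex Lie algebras with basis $z_1,z_2,z_3$ and the following brackets (all brackets of basis elements not determined by these are zero): - $L_2$: $[z_3,z_1]=z_1$, $[z_3,z_2]=z_2$; - $L_{3,a}$: $[z_3,z_1]=z_2$, $[z_3,z_2]=az_1+z_2$; - $L_4$: $[z_3,z_1]=z_2$, $[z_3,z_2]=z_1$; - $L_5$: $[z_3,z_1]=z_2$.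 **Theorem.** The following is a classification of the $3$-dimensional solvable subalgebras of $\mathfrak{sl}(3,\mathbb{C})$ up to inner automorphism, where $\alpha\in\mathbb{C}$, $\alpha\neq\pm1$, and $a(\alpha)=-\frac{(2\alpha-1)(\alpha-2)}{9(\alpha-1)^2}$: $$\begin{aligned} L_2^1&=\langle x_1,x_3,2h_1+h_2\rangle, & L_2^2&=\langle x_1,y_2,h_1-h_2\rangle,\\ L_{3,-1/4}^1&=\langle x_1,x_3,2h_1+h_2+x_2\rangle, & L_{3,-1/4}^2&=\langle y_1,y_3,2h_1+h_2+x_2\rangle,\\ L_{3,-2/9}^1&=\langle x_1+x_2,x_3,h_1+h_2\rangle, & L_{3,0}^1&=\langle x_1,h_1,h_2\rangle,\\ L_{3,a(\alpha)}^{1,\alpha}&=\langle x_1,x_3,(\alpha-1)h_1+\alpha h_2\rangle, & L_{3,a(\alpha)}^{2,\alpha}&=\langle x_1,y_2,h_1+\alpha h_2\rangle,\\ L_4^1&=\langle x_1,x_3,h_2\rangle, & L_4^2&=\langle x_1,y_2,h_1+h_2\rangle,\\ L_5^1&=\langle x_1,x_2,x_3\rangle. \end{aligned}$$ That is: each of these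 is a $3$-dimensional solvable subalgebra, isomorphic to the Lie algebra named by its subscript; every $3$-dimensional solvable subalgebra of $\mathfrak{sl}(3,\mathbb{C})$ is equivalent to one of them; and two differently labelled members of the list are inequivalent, except as follows. For $\alpha,\beta\in\mathbb{C}\setminus\{1,-1\}$ and each $i\in\{1,2\}$, $L_{3,a(\alpha)}^{i,\alpha}$ is equivalent to $L_{3,a(\beta)}^{i,\beta}$ if and only if $\alpha=\beta$ or $\alpha\beta=1$. -/

import Mathlib

/-- The inner automorphisms of a complex Lie algebra `L`: the subgroup of the automorphism group of
`L` generated by the automorphisms `exp (ad x)`, where `x` runs over the ad-nilpotent elements.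
If `(ad x) ^ n = 0`, then `exp (ad x)` is the finite sum of `(ad x) ^ i / i!` over `i < n`. -/
inductive IsInnerAut {L : Type*} [LieRing L] [LieAlgebra ℂ L] : (L ≃ₗ⁅ℂ⁆ L) → Prop
  | exp_ad (x : L) (n : ℕ) (hx : (LieAlgebra.ad ℂ L x) ^ n = 0) (φ : L ≃ₗ⁅ℂ⁆ L)
      (hφ : ∀ y : L, φ y =
        ∑ i ∈ Finset.range n, ((i.factorial : ℂ)⁻¹) • ((LieAlgebra.ad ℂ L x) ^ i) y) : IsInnerAut φ
  | refl : IsInnerAut LieEquiv.refl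
  | symm (φ : L ≃ₗ⁅ℂ⁆ L) (hφ : IsInnerAut φ) : IsInnerAut φ.symm
  | trans (φ ψ : L ≃ₗ⁅ℂ⁆ L) (hφ : IsInnerAut φ) (hψ : IsInnerAut ψ) : IsInnerAut (φ.trans ψ)

/-- Two subalgebras are equivalent up to inner automorphism if some inner automorphism of the
ambient Lie algebra maps the first one onto the second one. -/
def InnerEquivalent {L : Type*} [LieRing L] [LieAlgebra ℂ L] (K K' : LieSubalgebra ℂ L) : Prop :=
  ∃ φ : L ≃ₗ⁅ℂ⁆ L, IsInnerAut φ ∧ K.map (φ : L →ₗ⁅ℂ⁆ L) = K'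

/-! ### Isomorphism types of three-dimensional solvable Lie algebras

`T` has the given type if it has a basis `z₁, z₂, z₃` (indexed here by `0, 1, 2`) satisfying the
listed commutation relations. -/

/-- `T` is isomorphic to `L₂`: `[z₃, z₁] = z₁`, `[z₃, z₂] = z₂`, `[z₁, z₂] = 0`. -/
def IsTypeL2 (T : Type*) [LieRing T] [LieAlgebra ℂ T] : Prop :=
  ∃ z : Module.Basis (Fin 3) ℂ T, ⁅z 2, z 0⁆ = z 0 ∧ ⁅z 2, z 1⁆ = z 1 ∧ ⁅z 0, z 1⁆ = 0

/-- `T` is isomorphic to `L_{3,a}`: `[z₃, z₁] = z₂`, `[z₃, z₂] = a z₁ + z₂`, `[z₁, z₂] = 0`. -/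
def IsTypeL3 (a : ℂ) (T : Type*) [LieRing T] [LieAlgebra ℂ T] : Prop :=
  ∃ z : Module.Basis (Fin 3) ℂ T,
    ⁅z 2, z 0⁆ = z 1 ∧ ⁅z 2, z 1⁆ = a • z 0 + z 1 ∧ ⁅z 0, z 1⁆ = 0

/-- `T` is isomorphic to `L₄`: `[z₃, z₁] = z₂`, `[z₃, z₂] = z₁`, `[z₁, z₂] = 0`. -/
def IsTypeL4 (T : Type*) [LieRing T] [LieAlgebra ℂ T] : Prop :=
  ∃ z : Module.Basis (Fin 3) ℂ T, ⁅z 2, z 0⁆ = z 1 ∧ ⁅z 2, z 1⁆ = z 0 ∧ ⁅z 0, z 1⁆ = 0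

/-- `T` is isomorphic to `L₅`: `[z₃, z₁] = z₂`, `[z₃, z₂] = 0`, `[z₁, z₂] = 0`. -/
def IsTypeL5 (T : Type*) [LieRing T] [LieAlgebra ℂ T] : Prop :=
  ∃ z : Module.Basis (Fin 3) ℂ T, ⁅z 2, z 0⁆ = z 1 ∧ ⁅z 2, z 1⁆ = 0 ∧ ⁅z 0, z 1⁆ = 0

namespace A2

/-- The simple Lie algebra `A₂ = sl(3, ℂ)` of traceless complex `3 × 3` matrices. -/
abbrev Alg : Type := LieAlgebra.SpecialLinear.sl (Fin 3) ℂ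

/-- The general element `a h₁ + b h₂ + c x₁ + d x₂ + e x₃ + c' y₁ + d' y₂ + e' y₃` of `sl(3, ℂ)`. -/
def elt (a b c d e c' d' e' : ℂ) : Alg :=
  ⟨!![a, c, -e; c', b - a, d; -e', d', -b], by
    change Matrix.trace (n := Fin 3) (R := ℂ) _ = 0
    rw [Matrix.trace_fin_three]
    simp⟩

/-! The Chevalley basis. -/

/-- `h₁ = diag(1, -1, 0)`. -/
def h₁ : Alg := elt 1 0 0 0 0 0 0 0

/-- `h₂ = diag(0, 1, -1)`. -/
def h₂ : Alg := elt 0 1 0 0 0 0 0 0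

/-- `x₁ = E₁₂`. -/
def x₁ : Alg := elt 0 0 1 0 0 0 0 0

/-- `x₂ = E₂₃`. -/
def x₂ : Alg := elt 0 0 0 1 0 0 0 0

/-- `x₃ = -E₁₃`. -/
def x₃ : Alg := elt 0 0 0 0 1 0 0 0

/-- `y₁ = E₂₁`. -/
def y₁ : Alg := elt 0 0 0 0 0 1 0 0

/-- `y₂ = E₃₂`. -/
def y₂ : Alg := elt 0 0 0 0 0 0 1 0

/-- `y₃ = -E₃₁`. -/
def y₃ : Alg := elt 0 0 0 0 0 0 0 1

/-- The Lie subalgebra of `sl(3, ℂ)` generated by three elements. -/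
def gen (u v w : Alg) : LieSubalgebra ℂ Alg := LieSubalgebra.lieSpan ℂ Alg {u, v, w}

/-- Labels of the subalgebras in the list. The label `L_i_j` stands for the `j`-th subalgebra of
type `L_i`; `family₁ α` and `family₂ α` stand for the two one-parameter families, with `α ≠ ±1`. -/
inductive Label : Type
  | L2_1
  | L2_2
  | L3_quarter_1
  | L3_quarter_2
  | L3_two_ninths
  | L3_zero
  | family₁ (α : ℂ) (h1 : α ≠ 1) (h2 : α ≠ -1)
  | family₂ (α : ℂ) (h1 : α ≠ 1) (h2 : α ≠ -1)
  | L4_1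
  | L4_2
  | L5_1

/-- The list of subalgebras of `sl(3, ℂ)`. -/
def subalg : Label → LieSubalgebra ℂ Alg
  | .L2_1 => gen x₁ x₃ ((2 : ℂ) • h₁ + h₂)
  | .L2_2 => gen x₁ y₂ (h₁ - h₂)
  | .L3_quarter_1 => gen x₁ x₃ ((2 : ℂ) • h₁ + h₂ + x₂)
  | .L3_quarter_2 => gen y₁ y₃ ((2 : ℂ) • h₁ + h₂ + x₂)
  | .L3_two_ninths => gen (x₁ + x₂) x₃ (h₁ + h₂)
  | .L3_zero => gen x₁ h₁ h₂
  | .family₁ α _ _ => gen x₁ x₃ ((α - 1) • h₁ + α • h₂)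
  | .family₂ α _ _ => gen x₁ y₂ (h₁ + α • h₂)
  | .L4_1 => gen x₁ x₃ h₂
  | .L4_2 => gen x₁ y₂ (h₁ + h₂)
  | .L5_1 => gen x₁ x₂ x₃

/-- The isomorphism type attached to each label. -/
def HasListedType (T : Type*) [LieRing T] [LieAlgebra ℂ T] : Label → Prop
  | .L2_1 => IsTypeL2 T
  | .L2_2 => IsTypeL2 T
  | .L3_quarter_1 => IsTypeL3 (-(1 / 4)) T
  | .L3_quarter_2 => IsTypeL3 (-(1 / 4)) T
  | .L3_two_ninths => IsTypeL3 (-(2 / 9)) T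
  | .L3_zero => IsTypeL3 0 T
  | .family₁ α _ _ => IsTypeL3 (-((2 * α - 1) * (α - 2) / (9 * (α - 1) ^ 2))) T
  | .family₂ α _ _ => IsTypeL3 (-((2 * α - 1) * (α - 2) / (9 * (α - 1) ^ 2))) T
  | .L4_1 => IsTypeL4 T
  | .L4_2 => IsTypeL4 T
  | .L5_1 => IsTypeL5 T

end A2

/-!
Every inner automorphism of `sl(n, ℂ)` is conjugation by an invertible matrix: an ad-nilpotent
`x` is a nilpotent matrix, and `exp (ad x)` is conjugation by `exp x`. Conversely, after rescaling
to determinant one, an invertible matrix is a product of transvections, which are exponentials of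
nilpotent matrices, so equivalence is conjugacy under `GL n ℂ`.

By Lie's theorem a solvable subalgebra is conjugate to one consisting of upper triangular matrices.
If `K` is such a subalgebra of dimension three, its projection to the diagonal has rank zero, one
or two, and its strictly upper triangular part has the complementary dimension. Rank zero leaves
only `⟨x₁, x₂, x₃⟩`. In rank one `K` contains `x₃` and some `p x₁ + q x₂`; in rank two a conjugate
of `K` contains the diagonal matrices, under which the remaining element splits into root vectors.
The involution `X ↦ -Xᵀ` exchanges the two halves of the list.

Inequivalent members of the list are told apart by polynomial identities valid on the subalgebra
or on its nilpotent elements, except that within a family one compares eigenvalues: the nilpotent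
elements share a one-dimensional image (or, dually, a kernel of codimension one), and the eigenvalue
of an element on this line, relative to its other eigenvalues, determines `α` up to `α ↦ α⁻¹`.
-/

open Matrix LieAlgebra.SpecialLinear

theorem InnerEquivalent.refl {L : Type*} [LieRing L] [LieAlgebra ℂ L] (K : LieSubalgebra ℂ L) :
    InnerEquivalent K K :=
  ⟨_, .refl, by ext; simp⟩

theorem InnerEquivalent.symm {L : Type*} [LieRing L] [LieAlgebra ℂ L] {K K' : LieSubalgebra ℂ L}
    (h : InnerEquivalent K K') : InnerEquivalent K' K := by
  obtain ⟨φ, hφ, rfl⟩ := h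
  refine ⟨φ.symm, hφ.symm, ?_⟩
  ext X
  simp [LieSubalgebra.mem_map]

theorem InnerEquivalent.trans {L : Type*} [LieRing L] [LieAlgebra ℂ L]
    {K K' K'' : LieSubalgebra ℂ L} (h : InnerEquivalent K K') (h' : InnerEquivalent K' K'') :
    InnerEquivalent K K'' := by
  obtain ⟨φ, hφ, rfl⟩ := h
  obtain ⟨ψ, hψ, rfl⟩ := h'
  refine ⟨φ.trans ψ, hφ.trans φ ψ hψ, ?_⟩
  ext X
  simp [LieSubalgebra.mem_map]

theorem finrank_map_lieEquiv {R L L' : Type*} [CommRing R] [LieRing L] [LieAlgebra R L]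
    [LieRing L'] [LieAlgebra R L'] (K : LieSubalgebra R L) (φ : L ≃ₗ⁅R⁆ L') :
    Module.finrank R (K.map (φ : L →ₗ⁅R⁆ L')) = Module.finrank R K :=
  LinearEquiv.finrank_map_eq φ.toLinearEquiv K.toSubmodule

section Conjugation

variable {n R : Type*} [Fintype n] [DecidableEq n] [CommRing R]

theorem mem_sl_iff_trace_eq_zero {X : Matrix n n R} : X ∈ sl n R ↔ X.trace = 0 :=
  LinearMap.mem_ker

/-- Conjugation `X ↦ P X P⁻¹` as an automorphism of `sl n R`. -/
def slConj (P : GL n R) : sl n R ≃ₗ⁅R⁆ sl n R where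
  toFun X := ⟨P * X * P⁻¹.val, mem_sl_iff_trace_eq_zero.2 <| by
    rw [trace_units_conj, mem_sl_iff_trace_eq_zero.1 X.2]⟩
  invFun X := ⟨P⁻¹.val * X * P, mem_sl_iff_trace_eq_zero.2 <| by
    rw [trace_units_conj', mem_sl_iff_trace_eq_zero.1 X.2]⟩
  map_add' X Y := Subtype.ext (by simp [mul_add, add_mul])
  map_smul' c X := Subtype.ext (by simp)
  map_lie' {X Y} := Subtype.ext (by simp only [sl_bracket]; simp [mul_sub, sub_mul, mul_assoc])
  left_inv X := Subtype.ext (by simp [mul_assoc])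
  right_inv X := Subtype.ext (by simp [mul_assoc])

theorem coe_slConj (P : GL n R) (X : sl n R) :
    (slConj P X : Matrix n n R) = P * X * P⁻¹.val := rfl

theorem slConj_eq_iff {P : GL n R} {X Y : sl n R} :
    slConj P X = Y ↔ (P : Matrix n n R) * X = Y * P := by
  rw [← Units.mul_inv_eq_iff_eq_mul, ← coe_slConj, SetLike.coe_eq_coe]

theorem slConj_one : slConj (1 : GL n R) = LieEquiv.refl :=
  LieEquiv.ext fun _ ↦ slConj_eq_iff.2 (by simp)

theorem slConj_mul (P Q : GL n R) : slConj (P * Q) = (slConj Q).trans (slConj P) :=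
  LieEquiv.ext fun _ ↦ slConj_eq_iff.2 (by simp [coe_slConj, mul_assoc])

theorem slConj_inv (P : GL n R) : slConj P⁻¹ = (slConj P).symm := by
  refine LieEquiv.ext fun X ↦ (slConj P).injective (.trans ?_ ((slConj P).apply_symm_apply X).symm)
  exact Subtype.ext (by simp [coe_slConj, mul_assoc])

end Conjugation

section Nilpotent

variable {n K : Type*} [Fintype n] [DecidableEq n] [Field K]

theorem exists_mulVec_eq_smul_of_isRoot_charpoly {A : Matrix n n K} {r : K}
    (hr : A.charpoly.IsRoot r) : ∃ v, v ≠ 0 ∧ A *ᵥ v = r • v := by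
  rw [Polynomial.IsRoot, eval_charpoly] at hr
  obtain ⟨v, hv, h⟩ := exists_mulVec_eq_zero_iff.2 hr
  exact ⟨v, hv, by simpa [sub_mulVec, sub_eq_zero, eq_comm] using h⟩

theorem ad_pow_apply_of_lie_eq_smul {L : Type*} [LieRing L] [LieAlgebra K L] {x y : L} {c : K}
    (h : ⁅x, y⁆ = c • y) (k : ℕ) : (LieAlgebra.ad K L x ^ k) y = c ^ k • y := by
  induction k with
  | zero => simp
  | succ k ih =>
    rw [pow_succ, Module.End.mul_apply, LieAlgebra.ad_apply, h, map_smul, ih, smul_smul, pow_succ']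

theorem eq_of_isRoot_charpoly_of_isNilpotent_ad {x : sl n K}
    (hx : IsNilpotent (LieAlgebra.ad K (sl n K) x)) {r s : K}
    (hr : (x : Matrix n n K).charpoly.IsRoot r) (hs : (x : Matrix n n K).charpoly.IsRoot s) :
    r = s := by
  by_contra hrs
  rw [← charpoly_transpose] at hs
  obtain ⟨v, hv, hxv⟩ := exists_mulVec_eq_smul_of_isRoot_charpoly hr
  obtain ⟨w, hw, hxw⟩ := exists_mulVec_eq_smul_of_isRoot_charpoly hs
  rw [mulVec_transpose] at hxw
  have left : (x : Matrix n n K) * vecMulVec v w = r • vecMulVec v w := by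
    rw [mul_vecMulVec, hxv, smul_vecMulVec]
  have right : vecMulVec v w * (x : Matrix n n K) = s • vecMulVec v w := by
    rw [vecMulVec_mul, hxw, vecMulVec_smul]
  have trace_eq_zero : (vecMulVec v w).trace = 0 := by
    have := trace_mul_comm (x : Matrix n n K) (vecMulVec v w)
    rw [left, right, trace_smul, trace_smul] at this
    by_contra h
    exact hrs (mul_right_cancel₀ h this)
  let y : sl n K := ⟨vecMulVec v w, mem_sl_iff_trace_eq_zero.2 trace_eq_zero⟩
  have lie_eq : ⁅x, y⁆ = (r - s) • y :=
    Subtype.ext (by rw [sl_bracket]; exact (congrArg₂ _ left right).trans (sub_smul r s _).symm)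
  obtain ⟨k, hk⟩ := hx
  have y_eq_zero : y = 0 := by
    simpa [hk, sub_eq_zero, hrs] using (ad_pow_apply_of_lie_eq_smul lie_eq k).symm
  exact (vecMulVec_ne_zero hv hw) (congrArg Subtype.val y_eq_zero)

theorem isNilpotent_of_isNilpotent_ad [IsAlgClosed K] [CharZero K] {x : sl n K}
    (hx : IsNilpotent (LieAlgebra.ad K (sl n K) x)) : IsNilpotent (x : Matrix n n K) := by
  set χ := (x : Matrix n n K).charpoly
  have hχ : χ.Splits := IsAlgClosed.splits χ
  have hmonic : χ.Monic := charpoly_monic _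
  have roots_eq_zero : ∀ r ∈ χ.roots, r = 0 := by
    intro r hr
    have hroots : χ.roots = Multiset.replicate χ.roots.card r :=
      Multiset.eq_replicate_card.2 fun s hs ↦ eq_of_isRoot_charpoly_of_isNilpotent_ad hx
        (Polynomial.isRoot_of_mem_roots hs) (Polynomial.isRoot_of_mem_roots hr)
    have htrace := trace_eq_sum_roots_charpoly (x : Matrix n n K)
    rw [mem_sl_iff_trace_eq_zero.1 x.2, hroots, Multiset.sum_replicate, eq_comm, nsmul_eq_mul,
      mul_eq_zero, Nat.cast_eq_zero] at htrace
    exact htrace.resolve_left (Multiset.card_pos_iff_exists_mem.2 ⟨r, hr⟩).ne'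
  have charpoly_eq : χ = Polynomial.X ^ χ.roots.card := by
    conv_lhs => rw [hχ.eq_prod_roots_of_monic hmonic, Multiset.eq_replicate_card.2 roots_eq_zero]
    simp
  refine ⟨χ.roots.card, ?_⟩
  rw [← Polynomial.aeval_X_pow (R := K), ← charpoly_eq, aeval_self_charpoly]

end Nilpotent

section Exponential

variable {n : Type*} [Fintype n] [DecidableEq n]

theorem coe_ad_pow_apply {R : Type*} [CommRing R] (x y : sl n R) (k : ℕ) :
    ((LieAlgebra.ad R (sl n R) x ^ k) y : Matrix n n R) =
      ((LinearMap.mulLeft R (x : Matrix n n R) - LinearMap.mulRight R (x : Matrix n n R)) ^ k)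
        (y : Matrix n n R) := by
  induction k with
  | zero => rfl
  | succ k ih => rw [pow_succ', pow_succ', Module.End.mul_apply, Module.End.mul_apply, ← ih]; rfl

theorem exp_mulLeft_sub_mulRight_apply (R : Type*) {A : Type*} [CommRing R] [Ring A] [Algebra R A]
    [Algebra ℚ A] {a : A} (ha : IsNilpotent a) (b : A) :
    IsNilpotent.exp (LinearMap.mulLeft R a - LinearMap.mulRight R a) b =
      IsNilpotent.exp a * b * IsNilpotent.exp (-a) := by
  obtain ⟨k, hk⟩ := ha
  have hk' : (-a) ^ k = 0 := by rw [neg_pow, hk, mul_zero]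
  have hl : LinearMap.mulLeft R a ^ k = 0 := by simp [hk]
  have hr : LinearMap.mulRight R (-a) ^ k = 0 := by simp [LinearMap.pow_mulRight, hk']
  have exp_left (c : A) : IsNilpotent.exp (LinearMap.mulLeft R a) c = IsNilpotent.exp a * c := by
    simp [IsNilpotent.exp_eq_sum hl, IsNilpotent.exp_eq_sum hk, Finset.sum_mul]
  have exp_right (c : A) :
      IsNilpotent.exp (LinearMap.mulRight R (-a)) c = c * IsNilpotent.exp (-a) := by
    simp [IsNilpotent.exp_eq_sum hr, IsNilpotent.exp_eq_sum hk', Finset.mul_sum,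
      LinearMap.pow_mulRight]
  have sub_eq_add : LinearMap.mulLeft R a - LinearMap.mulRight R a =
      LinearMap.mulLeft R a + LinearMap.mulRight R (-a) := by
    ext
    simp [sub_eq_add_neg]
  rw [sub_eq_add, IsNilpotent.exp_add_of_commute (LinearMap.commute_mulLeft_right a (-a))
    ⟨k, hl⟩ ⟨k, hr⟩, Module.End.mul_apply, exp_left, exp_right, mul_assoc]

theorem sum_ad_pow_apply_eq_slConj {x y : sl n ℂ} (hx : IsNilpotent (x : Matrix n n ℂ)) {k : ℕ}
    (hk : (LieAlgebra.ad ℂ (sl n ℂ) x ^ k) y = 0) :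
    ∑ i ∈ Finset.range k, (i.factorial : ℂ)⁻¹ • (LieAlgebra.ad ℂ (sl n ℂ) x ^ i) y =
      slConj (IsNilpotent.isUnit_exp hx).unit y := by
  have hnil : IsNilpotent (LinearMap.mulLeft ℂ (x : Matrix n n ℂ) -
      LinearMap.mulRight ℂ (x : Matrix n n ℂ)) :=
    (LinearMap.commute_mulLeft_right _ _).isNilpotent_sub
      (by rwa [LinearMap.isNilpotent_mulLeft_iff]) (by rwa [LinearMap.isNilpotent_mulRight_iff])
  have hk' := congrArg Subtype.val hk
  rw [coe_ad_pow_apply] at hk'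
  rw [Subtype.ext_iff, coe_slConj, IsUnit.unit_spec]
  have hinv : ((IsNilpotent.isUnit_exp hx).unit⁻¹).val = IsNilpotent.exp (-(x : Matrix n n ℂ)) :=
    Units.inv_eq_of_mul_eq_one_right (IsNilpotent.exp_mul_exp_neg_self hx)
  rw [hinv, ← exp_mulLeft_sub_mulRight_apply ℂ hx, ← Module.End.smul_def,
    IsNilpotent.exp_smul_eq_sum hk' hnil, AddSubmonoidClass.coe_finsetSum]
  refine Finset.sum_congr rfl fun i _ ↦ ?_
  rw [SetLike.val_smul, coe_ad_pow_apply, ← Rat.cast_smul_eq_qsmul ℂ]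
  simp

theorem IsInnerAut.exists_eq_slConj {φ : sl n ℂ ≃ₗ⁅ℂ⁆ sl n ℂ} (h : IsInnerAut φ) :
    ∃ P : GL n ℂ, φ = slConj P := by
  induction h with
  | exp_ad x k hk φ hφ =>
    have hx := isNilpotent_of_isNilpotent_ad ⟨k, hk⟩
    exact ⟨_, LieEquiv.ext fun y ↦
      (hφ y).trans (sum_ad_pow_apply_eq_slConj hx (by rw [hk, LinearMap.zero_apply]))⟩
  | refl => exact ⟨1, slConj_one.symm⟩
  | symm φ _ ih =>
    obtain ⟨P, rfl⟩ := ih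
    exact ⟨P⁻¹, (slConj_inv P).symm⟩
  | trans φ ψ _ _ ihφ ihψ =>
    obtain ⟨P, rfl⟩ := ihφ
    obtain ⟨Q, rfl⟩ := ihψ
    exact ⟨Q * P, (slConj_mul Q P).symm⟩

theorem isInnerAut_slConj_exp {x : sl n ℂ} (hx : IsNilpotent (x : Matrix n n ℂ)) :
    IsInnerAut (slConj (IsNilpotent.isUnit_exp hx).unit) := by
  obtain ⟨k, hk⟩ := LieAlgebra.isNilpotent_ad_of_isNilpotent (R := ℂ) hx
  exact .exp_ad x k hk _ fun y ↦
    (sum_ad_pow_apply_eq_slConj hx (by rw [hk, LinearMap.zero_apply])).symm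

end Exponential

section Inner

variable {n : Type*} [Fintype n] [DecidableEq n]

variable (n) in
/-- The invertible matrices conjugation by which is an inner automorphism of `sl n ℂ`. -/
def innerConjSubgroup : Subgroup (GL n ℂ) where
  carrier := {P | IsInnerAut (slConj P)}
  mul_mem' {P Q} hP hQ := by
    simpa only [Set.mem_ofPred_eq, slConj_mul] using hQ.trans _ _ hP
  one_mem' := by simpa only [Set.mem_ofPred_eq, slConj_one] using IsInnerAut.refl
  inv_mem' {P} hP := by simpa only [Set.mem_ofPred_eq, slConj_inv] using hP.symm

theorem transvection_eq_exp {i j : n} (hij : i ≠ j) (c : ℂ) :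
    transvection i j c = IsNilpotent.exp (Matrix.single i j c) := by
  rw [IsNilpotent.exp_eq_sum (k := 2) (by simp [sq, hij.symm])]
  simp [Finset.sum_range_succ, transvection]

theorem mem_innerConjSubgroup_of_eq_transvection {P : GL n ℂ} {i j : n} (hij : i ≠ j) {c : ℂ}
    (hP : P.val = transvection i j c) : P ∈ innerConjSubgroup n := by
  have hnil : IsNilpotent (single i j hij c : Matrix n n ℂ) := ⟨2, by simp [sq, hij.symm]⟩
  have hexp : P = (IsNilpotent.isUnit_exp hnil).unit :=
    Units.ext (hP.trans (transvection_eq_exp hij c))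
  exact hexp ▸ isInnerAut_slConj_exp hnil

/-- The homomorphism sending `d` to the diagonal matrix with entries `d i`. -/
def diagonalGL : (n → ℂˣ) →* GL n ℂ :=
  (Units.map (diagonalRingHom n ℂ).toMonoidHom).comp MulEquiv.piUnits.symm.toMonoidHom

theorem coe_diagonalGL (d : n → ℂˣ) :
    (diagonalGL d : Matrix n n ℂ) = diagonal fun i ↦ (d i : ℂ) := rfl

theorem diagonalGL_const_mem_innerConjSubgroup (c : ℂˣ) :
    diagonalGL (fun _ : n ↦ c) ∈ innerConjSubgroup n := by
  have h : slConj (diagonalGL fun _ : n ↦ c) = LieEquiv.refl :=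
    LieEquiv.ext fun X ↦ slConj_eq_iff.2 <| by
      rw [coe_diagonalGL, ← smul_one_eq_diagonal]
      simp
  exact (congrArg IsInnerAut h).mpr .refl

theorem coe_diagonalGL_mulSingle_div {i j : n} (hij : i ≠ j) (t : ℂˣ) :
    (diagonalGL (Pi.mulSingle i t / Pi.mulSingle j t) : Matrix n n ℂ) =
      transvection i j (t : ℂ) * transvection j i (-(t : ℂ)⁻¹) * transvection i j (t : ℂ) *
        (transvection i j (-1) * transvection j i 1 * transvection i j (-1)) := by
  have hdiag : (diagonalGL (Pi.mulSingle i t / Pi.mulSingle j t) : Matrix n n ℂ) =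
      1 + single i i ((t : ℂ) - 1) + single j j ((t : ℂ)⁻¹ - 1) := by
    ext k l
    rw [coe_diagonalGL]
    rcases eq_or_ne k l with rfl | hkl
    · rcases eq_or_ne k i with rfl | hki
      · simp [hij, hij.symm]
      · rcases eq_or_ne k j with rfl | hkj
        · simp [hij]
        · simp [hki, hkj, hki.symm, hkj.symm]
    · have h (m : n) : ¬(m = k ∧ m = l) := fun h ↦ hkl (h.1.symm.trans h.2)
      simp [hkl, h]
  rw [hdiag]
  simp only [transvection, mul_add, mul_one, add_mul, one_mul, single_mul_single_same, mul_neg,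
    ne_eq, Units.ne_zero, not_false_eq_true, mul_inv_cancel₀, hij.symm, single_mul_single_of_ne,
    add_zero, neg_mul, inv_mul_cancel₀, neg_neg, hij]
  ext k l
  simp only [Matrix.add_apply, single_apply]
  grind

theorem diagonalGL_mulSingle_div_mem_innerConjSubgroup (i j : n) (t : ℂˣ) :
    diagonalGL (Pi.mulSingle i t / Pi.mulSingle j t) ∈ innerConjSubgroup n := by
  rcases eq_or_ne i j with rfl | hij
  · rw [div_self', map_one]
    exact one_mem _
  have transvection_mem {i j : n} (hij : i ≠ j) (c : ℂ) :
      ∃ P ∈ innerConjSubgroup n, (P : Matrix n n ℂ) = transvection i j c :=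
    have hdet : (transvection i j c).det ≠ 0 := by simp [det_transvection_of_ne i j hij]
    ⟨GeneralLinearGroup.mkOfDetNeZero _ hdet,
      mem_innerConjSubgroup_of_eq_transvection hij rfl, rfl⟩
  choose T hT hT' using @transvection_mem
  have heq : diagonalGL (Pi.mulSingle i t / Pi.mulSingle j t) =
      T hij t * T hij.symm (-(t : ℂ)⁻¹) * T hij t * (T hij (-1) * T hij.symm 1 * T hij (-1)) :=
    Units.ext (by simp only [Units.val_mul, hT', coe_diagonalGL_mulSingle_div hij])
  rw [heq]
  exact mul_mem (mul_mem (mul_mem (hT _ _) (hT _ _)) (hT _ _))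
    (mul_mem (mul_mem (hT _ _) (hT _ _)) (hT _ _))

theorem diagonalGL_mulSingle_mem_innerConjSubgroup (i : n) (t : ℂˣ) :
    diagonalGL (Pi.mulSingle i t) ∈ innerConjSubgroup n := by
  obtain ⟨s, hs⟩ := IsAlgClosed.exists_pow_nat_eq (t : ℂ) (Fintype.card_pos_iff.2 ⟨i⟩)
  have hs0 : s ≠ 0 := by
    rintro rfl
    exact t.ne_zero (by rw [← hs, zero_pow (Fintype.card_pos_iff.2 ⟨i⟩).ne'])
  lift s to ℂˣ using hs0.isUnit
  have hts : t = s ^ Fintype.card n := Units.ext (by simpa using hs.symm)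
  have heq : Pi.mulSingle i t =
      (∏ j, Pi.mulSingle i s / Pi.mulSingle j s) * fun _ : n ↦ s := by
    rw [Finset.prod_div_distrib, Finset.univ_prod_mulSingle (fun _ ↦ s), div_mul_cancel,
      Finset.prod_const, Finset.card_univ, hts, Pi.mulSingle_pow]
  rw [heq, map_mul]
  refine mul_mem (Subgroup.mem_comap.1 (prod_mem fun j _ ↦ ?_))
    (diagonalGL_const_mem_innerConjSubgroup s)
  exact diagonalGL_mulSingle_div_mem_innerConjSubgroup i j s

theorem diagonalGL_mem_innerConjSubgroup (d : n → ℂˣ) : diagonalGL d ∈ innerConjSubgroup n := by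
  rw [← Finset.univ_prod_mulSingle d]
  exact Subgroup.mem_comap.1 (prod_mem fun i _ ↦ diagonalGL_mulSingle_mem_innerConjSubgroup i (d i))

theorem innerConjSubgroup_eq_top : innerConjSubgroup n = ⊤ := by
  refine eq_top_iff.2 fun P _ ↦ ?_
  refine diagonal_transvection_induction_of_det_ne_zero
    (fun A ↦ ∀ P : GL n ℂ, (P : Matrix n n ℂ) = A → P ∈ innerConjSubgroup n) P
    ((isUnit_iff_isUnit_det _).1 P.isUnit).ne_zero
    (fun d hd P hP ↦ ?_) (fun t P hP ↦ mem_innerConjSubgroup_of_eq_transvection t.hij hP)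
    (fun A B hA hB ihA ihB P hP ↦ ?_) P rfl
  · rw [det_diagonal, Finset.prod_ne_zero_iff] at hd
    lift d to n → ℂˣ using fun i ↦ (hd i (Finset.mem_univ i)).isUnit
    rw [show P = diagonalGL d from Units.ext hP]
    exact diagonalGL_mem_innerConjSubgroup d
  · rw [show P = GeneralLinearGroup.mkOfDetNeZero A hA * GeneralLinearGroup.mkOfDetNeZero B hB from
      Units.ext hP]
    exact mul_mem (ihA _ rfl) (ihB _ rfl)

theorem innerEquivalent_iff_exists_slConj {K K' : LieSubalgebra ℂ (sl n ℂ)} :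
    InnerEquivalent K K' ↔ ∃ P : GL n ℂ, K.map (slConj P : sl n ℂ →ₗ⁅ℂ⁆ sl n ℂ) = K' := by
  constructor
  · rintro ⟨φ, hφ, h⟩
    obtain ⟨P, rfl⟩ := hφ.exists_eq_slConj
    exact ⟨P, h⟩
  · rintro ⟨P, h⟩
    exact ⟨slConj P, (innerConjSubgroup_eq_top (n := n)).ge (Subgroup.mem_top P), h⟩

end Inner

section Duality

theorem ad_map_pow_apply {R L L' : Type*} [CommRing R] [LieRing L] [LieAlgebra R L]
    [LieRing L'] [LieAlgebra R L'] (ψ : L ≃ₗ⁅R⁆ L') (x y : L) (k : ℕ) :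
    (LieAlgebra.ad R L' (ψ x) ^ k) (ψ y) = ψ ((LieAlgebra.ad R L x ^ k) y) := by
  induction k with
  | zero => simp
  | succ k ih =>
    simp only [pow_succ', Module.End.mul_apply, ih, LieAlgebra.ad_apply, LieEquiv.map_lie]

variable {L L' : Type*} [LieRing L] [LieAlgebra ℂ L] [LieRing L'] [LieAlgebra ℂ L']

theorem IsInnerAut.conj {φ : L ≃ₗ⁅ℂ⁆ L} (h : IsInnerAut φ) (ψ : L ≃ₗ⁅ℂ⁆ L') :
    IsInnerAut ((ψ.symm.trans φ).trans ψ) := by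
  induction h with
  | exp_ad x k hk φ hφ =>
    refine .exp_ad (ψ x) k (LinearMap.ext fun y ↦ ?_) _ fun y ↦ ?_
    · obtain ⟨y, rfl⟩ := ψ.surjective y
      simp [ad_map_pow_apply, hk]
    · obtain ⟨y, rfl⟩ := ψ.surjective y
      simp [ad_map_pow_apply, hφ]
  | refl => exact (congrArg IsInnerAut (LieEquiv.ext fun y ↦ ψ.apply_symm_apply y)).mpr .refl
  | symm φ _ ih => exact ih.symm
  | trans φ φ' _ _ ih ih' =>
    convert ih.trans _ _ ih' using 1
    exact LieEquiv.ext fun y ↦ by simp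

theorem InnerEquivalent.map {K K' : LieSubalgebra ℂ L} (h : InnerEquivalent K K')
    (ψ : L ≃ₗ⁅ℂ⁆ L') :
    InnerEquivalent (K.map (ψ : L →ₗ⁅ℂ⁆ L')) (K'.map (ψ : L →ₗ⁅ℂ⁆ L')) := by
  obtain ⟨φ, hφ, rfl⟩ := h
  refine ⟨_, hφ.conj ψ, ?_⟩
  ext X
  simp [LieSubalgebra.mem_map]

end Duality

/-- The involution `X ↦ -Xᵀ` of `sl n R`. -/
def slNegTranspose (n R : Type*) [Fintype n] [DecidableEq n] [CommRing R] :
    sl n R ≃ₗ⁅R⁆ sl n R where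
  toFun X := ⟨-(X : Matrix n n R)ᵀ, mem_sl_iff_trace_eq_zero.2 <| by
    rw [trace_neg, trace_transpose, mem_sl_iff_trace_eq_zero.1 X.2, neg_zero]⟩
  invFun X := ⟨-(X : Matrix n n R)ᵀ, mem_sl_iff_trace_eq_zero.2 <| by
    rw [trace_neg, trace_transpose, mem_sl_iff_trace_eq_zero.1 X.2, neg_zero]⟩
  map_add' X Y := Subtype.ext <| by
    change -((X : Matrix n n R) + (Y : Matrix n n R))ᵀ = -(X : Matrix n n R)ᵀ + -(Y : Matrix n n R)ᵀ
    rw [transpose_add, neg_add]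
  map_smul' c X := Subtype.ext <| by
    change -(c • (X : Matrix n n R))ᵀ = c • -(X : Matrix n n R)ᵀ
    rw [transpose_smul, smul_neg]
  map_lie' {X Y} := Subtype.ext <| by
    simp only [sl_bracket, transpose_sub, transpose_mul, neg_mul_neg, neg_sub]
  left_inv X := Subtype.ext (by simp)
  right_inv X := Subtype.ext (by simp)

theorem coe_slNegTranspose {n R : Type*} [Fintype n] [DecidableEq n] [CommRing R] (X : sl n R) :
    (slNegTranspose n R X : Matrix n n R) = -(X : Matrix n n R)ᵀ := rfl

section Solvable

variable {R L : Type*} [CommRing R] [LieRing L] [LieAlgebra R L]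

theorem coe_lieSpan_eq_span_of_forall_lie_mem {s : Set L}
    (hs : ∀ x ∈ s, ∀ y ∈ s, ⁅x, y⁆ ∈ Submodule.span R s) :
    (LieSubalgebra.lieSpan R L s : Submodule R L) = Submodule.span R s := by
  have lie_mem {x y : L} (hx : x ∈ Submodule.span R s) (hy : y ∈ Submodule.span R s) :
      ⁅x, y⁆ ∈ Submodule.span R s := by
    induction hx, hy using Submodule.span_induction₂ with
    | mem_mem x y hx hy => exact hs x hx y hy
    | zero_left y _ => simp
    | zero_right x _ => simp
    | add_left x y z _ _ _ hx hy => simpa using add_mem hx hy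
    | add_right x y z _ _ _ hx hy => simpa using add_mem hx hy
    | smul_left r x y _ _ h => simpa using Submodule.smul_mem _ r h
    | smul_right r x y _ _ h => simpa using Submodule.smul_mem _ r h
  refine le_antisymm ?_ LieSubalgebra.submodule_span_le_lieSpan
  exact LieSubalgebra.lieSpan_le (K := { Submodule.span R s with lie_mem' := lie_mem }).2
    Submodule.subset_span

theorem isSolvable_of_abelian_ker {f : L →ₗ[R] R} (hf : ∀ x y : L, f ⁅x, y⁆ = 0)
    (hab : ∀ x y : L, f x = 0 → f y = 0 → ⁅x, y⁆ = 0) : LieAlgebra.IsSolvable L := by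
  let J : LieIdeal R L := { LinearMap.ker f with lie_mem := fun {x y} _ ↦ hf x y }
  have first_le : LieAlgebra.derivedSeries R L 1 ≤ J := by
    rw [LieAlgebra.derivedSeries_def, LieAlgebra.derivedSeriesOfIdeal_succ, LieSubmodule.lie_le_iff]
    exact fun x _ y _ ↦ hf x y
  refine LieAlgebra.IsSolvable.mk (R := R) (k := 2) ?_
  rw [eq_bot_iff, LieAlgebra.derivedSeries_def, LieAlgebra.derivedSeriesOfIdeal_succ,
    LieSubmodule.lie_le_iff]
  exact fun x hx y hy ↦ (LieSubmodule.mem_bot _).2 (hab x y (first_le hx) (first_le hy))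

/-- `z 0` and `z 1` commute and `ad (z 2)` acts on them by the rows of `A`: the bracket relations of
the semidirect products of a line with an abelian plane, which cover the types `L₂` to `L₅`. -/
structure SatisfiesBrackets (A : Matrix (Fin 2) (Fin 2) R) (z : Fin 3 → L) : Prop where
  lie_two_zero : ⁅z 2, z 0⁆ = A 0 0 • z 0 + A 0 1 • z 1
  lie_two_one : ⁅z 2, z 1⁆ = A 1 0 • z 0 + A 1 1 • z 1
  lie_zero_one : ⁅z 0, z 1⁆ = 0

namespace SatisfiesBrackets

variable {A : Matrix (Fin 2) (Fin 2) R}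

theorem lie_sum_smul {z : Fin 3 → L} (hz : SatisfiesBrackets A z) (a b : Fin 3 → R) :
    ⁅∑ i, a i • z i, ∑ i, b i • z i⁆ =
      ((a 2 * b 0 - a 0 * b 2) * A 0 0 + (a 2 * b 1 - a 1 * b 2) * A 1 0) • z 0 +
      ((a 2 * b 0 - a 0 * b 2) * A 0 1 + (a 2 * b 1 - a 1 * b 2) * A 1 1) • z 1 := by
  have h10 : ⁅z 1, z 0⁆ = 0 := by rw [← lie_skew, hz.lie_zero_one, neg_zero]
  have h02 := lie_skew (z 0) (z 2)
  have h12 := lie_skew (z 1) (z 2)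
  rw [hz.lie_two_zero] at h02
  rw [hz.lie_two_one] at h12
  simp only [Fin.sum_univ_three, add_lie, lie_add, smul_lie, lie_smul, hz.lie_two_zero,
    hz.lie_two_one, hz.lie_zero_one, h10, ← h02, ← h12, lie_self]
  module

theorem lie_mem_span {z : Fin 3 → L} (hz : SatisfiesBrackets A z) {x y : L}
    (hx : x ∈ Submodule.span R (Set.range z)) (hy : y ∈ Submodule.span R (Set.range z)) :
    ⁅x, y⁆ ∈ Submodule.span R (Set.range z) := by
  obtain ⟨a, rfl⟩ := (Submodule.mem_span_range_iff_exists_fun R).1 hx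
  obtain ⟨b, rfl⟩ := (Submodule.mem_span_range_iff_exists_fun R).1 hy
  rw [hz.lie_sum_smul]
  exact add_mem (Submodule.smul_mem _ _ (Submodule.subset_span ⟨0, rfl⟩))
    (Submodule.smul_mem _ _ (Submodule.subset_span ⟨1, rfl⟩))

theorem isSolvable {z : Module.Basis (Fin 3) R L} (hz : SatisfiesBrackets A z) :
    LieAlgebra.IsSolvable L := by
  refine isSolvable_of_abelian_ker (f := z.coord 2) (fun x y ↦ ?_) fun x y hx hy ↦ ?_
  · rw [← z.sum_repr x, ← z.sum_repr y, hz.lie_sum_smul]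
    simp
  · rw [z.coord_apply] at hx hy
    rw [← z.sum_repr x, ← z.sum_repr y, hz.lie_sum_smul]
    simp [hx, hy]

theorem comap_subtype {K : LieSubalgebra R L} {z : Fin 3 → K}
    (hz : SatisfiesBrackets A (fun i ↦ (z i : L))) : SatisfiesBrackets A z :=
  ⟨Subtype.ext hz.1, Subtype.ext hz.2, Subtype.ext hz.3⟩

end SatisfiesBrackets

end Solvable

theorem span_range_eq_of_linearIndependent {K V : Type*} [Field K] [AddCommGroup V] [Module K V]
    {n : ℕ} {u z : Fin n → V} (hz : LinearIndependent K z)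
    (hmem : ∀ i, z i ∈ Submodule.span K (Set.range u)) :
    Submodule.span K (Set.range z) = Submodule.span K (Set.range u) := by
  have := FiniteDimensional.span_of_finite K (Set.finite_range u)
  refine Submodule.eq_of_le_of_finrank_le (Submodule.span_le.2 (Set.range_subset_iff.2 hmem)) ?_
  rw [finrank_span_eq_card hz]
  exact finrank_range_le_card u

theorem SatisfiesBrackets.coe_lieSpan_eq_span {K L : Type*} [Field K] [LieRing L] [LieAlgebra K L]
    {A : Matrix (Fin 2) (Fin 2) K} {u z : Fin 3 → L} (hA : SatisfiesBrackets A z)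
    (hspan : Submodule.span K (Set.range z) = Submodule.span K (Set.range u)) :
    (LieSubalgebra.lieSpan K L (Set.range u) : Submodule K L) =
      Submodule.span K (Set.range u) := by
  refine coe_lieSpan_eq_span_of_forall_lie_mem fun x hx y hy ↦ ?_
  rw [← hspan]
  apply hA.lie_mem_span <;> rw [hspan]
  exacts [Submodule.subset_span hx, Submodule.subset_span hy]

theorem SatisfiesBrackets.exists_basis {K L : Type*} [Field K] [LieRing L] [LieAlgebra K L]
    {A : Matrix (Fin 2) (Fin 2) K} {z : Fin 3 → L} (hA : SatisfiesBrackets A z)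
    (hz : LinearIndependent K z) {T : LieSubalgebra K L}
    (hT : Submodule.span K (Set.range z) = T) :
    ∃ b : Module.Basis (Fin 3) K T, SatisfiesBrackets A b := by
  refine ⟨(Module.Basis.span hz).map (LinearEquiv.ofEq _ _ hT), .comap_subtype ?_⟩
  convert hA using 2 with i
  exact congrArg Subtype.val (Module.Basis.span_apply hz i)

namespace A2

section Coordinates

theorem coe_elt (a b c d e c' d' e' : ℂ) :
    (elt a b c d e c' d' e' : Matrix (Fin 3) (Fin 3) ℂ) =
      !![a, c, -e; c', b - a, d; -e', d', -b] := rfl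

variable {a b c d e f g h a' b' c' d' e' f' g' h' : ℂ}

theorem elt_inj :
    elt a b c d e f g h = elt a' b' c' d' e' f' g' h' ↔
      a = a' ∧ b = b' ∧ c = c' ∧ d = d' ∧ e = e' ∧ f = f' ∧ g = g' ∧ h = h' := by
  refine ⟨fun H ↦ ?_, by rintro ⟨rfl, rfl, rfl, rfl, rfl, rfl, rfl, rfl⟩; rfl⟩
  have entry (i j : Fin 3) := congrFun₂ (congrArg Subtype.val H) i j
  simp only [coe_elt] at entry
  simpa using And.intro (entry 0 0) <| And.intro (entry 2 2) <| And.intro (entry 0 1) <|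
    And.intro (entry 1 2) <| And.intro (entry 0 2) <| And.intro (entry 1 0) <|
    And.intro (entry 2 1) (entry 2 0)

theorem elt_zero : elt 0 0 0 0 0 0 0 0 = 0 :=
  Subtype.ext <| by
    rw [coe_elt]
    ext i j
    fin_cases i <;> fin_cases j <;> simp

theorem elt_add :
    elt a b c d e f g h + elt a' b' c' d' e' f' g' h' =
      elt (a + a') (b + b') (c + c') (d + d') (e + e') (f + f') (g + g') (h + h') :=
  Subtype.ext <| by
    rw [AddMemClass.coe_add, coe_elt, coe_elt, coe_elt]
    ext i j
    fin_cases i <;> fin_cases j <;> simp <;> ring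

theorem elt_sub :
    elt a b c d e f g h - elt a' b' c' d' e' f' g' h' =
      elt (a - a') (b - b') (c - c') (d - d') (e - e') (f - f') (g - g') (h - h') :=
  Subtype.ext <| by
    rw [AddSubgroupClass.coe_sub, coe_elt, coe_elt, coe_elt]
    ext i j
    fin_cases i <;> fin_cases j <;> simp <;> ring

theorem smul_elt {t : ℂ} :
    t • elt a b c d e f g h =
      elt (t * a) (t * b) (t * c) (t * d) (t * e) (t * f) (t * g) (t * h) :=
  Subtype.ext <| by
    rw [SetLike.val_smul, coe_elt, coe_elt]
    ext i j
    fin_cases i <;> fin_cases j <;> simp [mul_sub]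

theorem lie_elt :
    ⁅elt a b c d e f g h, elt a' b' c' d' e' f' g' h'⁆ =
      elt (c * f' + e * h' - c' * f - e' * h) (d * g' + e * h' - d' * g - e' * h)
        (a * c' + c * (b' - a') - e * g' - a' * c - c' * (b - a) + e' * g)
        (-f * e' + (b - a) * d' - d * b' + f' * e - (b' - a') * d + d' * b)
        (a * e' - c * d' - e * b' - a' * e + c' * d + e' * b)
        (f * a' + (b - a) * f' - d * h' - f' * a - (b' - a') * f + d' * h)
        (-h * c' + g * (b' - a') - b * g' + h' * c - g' * (b - a) + b' * g)
        (h * a' - g * f' - b * h' - h' * a + g' * f + b' * h) :=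
  Subtype.ext <| by
    rw [sl_bracket, coe_elt, coe_elt, coe_elt]
    ext i j
    fin_cases i <;> fin_cases j <;> simp <;> ring

theorem slNegTranspose_elt :
    slNegTranspose (Fin 3) ℂ (elt a b c d e f g h) =
      elt (-a) (-b) (-f) (-g) (-h) (-c) (-d) (-e) :=
  Subtype.ext <| by
    rw [coe_slNegTranspose, coe_elt, coe_elt]
    ext i j
    fin_cases i <;> fin_cases j <;> simp [add_comm, sub_eq_add_neg]

theorem exists_eq_elt (X : Alg) : ∃ a b c d e f g h : ℂ, X = elt a b c d e f g h := by
  have htr := mem_sl_iff_trace_eq_zero.1 X.2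
  rw [trace_fin_three] at htr
  refine ⟨X.1 0 0, -X.1 2 2, X.1 0 1, X.1 1 2, -X.1 0 2, X.1 1 0, X.1 2 1, -X.1 2 0,
    Subtype.ext ?_⟩
  rw [coe_elt, eta_fin_three X.1]
  ext i j
  fin_cases i <;> fin_cases j <;> simp
  linear_combination htr

end Coordinates

/-- The three generators of `subalg l`. -/
def generators : Label → Fin 3 → Alg
  | .L2_1 => ![x₁, x₃, (2 : ℂ) • h₁ + h₂]
  | .L2_2 => ![x₁, y₂, h₁ - h₂]
  | .L3_quarter_1 => ![x₁, x₃, (2 : ℂ) • h₁ + h₂ + x₂]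
  | .L3_quarter_2 => ![y₁, y₃, (2 : ℂ) • h₁ + h₂ + x₂]
  | .L3_two_ninths => ![x₁ + x₂, x₃, h₁ + h₂]
  | .L3_zero => ![x₁, h₁, h₂]
  | .family₁ α _ _ => ![x₁, x₃, (α - 1) • h₁ + α • h₂]
  | .family₂ α _ _ => ![x₁, y₂, h₁ + α • h₂]
  | .L4_1 => ![x₁, x₃, h₂]
  | .L4_2 => ![x₁, y₂, h₁ + h₂]
  | .L5_1 => ![x₁, x₂, x₃]

theorem subalg_eq_lieSpan (l : Label) :
    subalg l = LieSubalgebra.lieSpan ℂ Alg (Set.range (generators l)) := by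
  cases l <;> simp only [subalg, gen, generators, range_cons, range_empty, Set.union_empty,
    Set.singleton_union]

/-- The linear combination of the generators of `subalg l` with coefficients `a`, `b`, `c`, written
out in the coordinates of `elt`. -/
def point (l : Label) (a b c : ℂ) : Alg :=
  match l with
  | .L2_1 => elt (2 * c) c a 0 b 0 0 0
  | .L2_2 => elt c (-c) a 0 0 0 b 0
  | .L3_quarter_1 => elt (2 * c) c a c b 0 0 0
  | .L3_quarter_2 => elt (2 * c) c 0 c 0 a 0 b
  | .L3_two_ninths => elt c c a a b 0 0 0
  | .L3_zero => elt b c a 0 0 0 0 0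
  | .family₁ α _ _ => elt (c * (α - 1)) (c * α) a 0 b 0 0 0
  | .family₂ α _ _ => elt c (c * α) a 0 0 0 b 0
  | .L4_1 => elt 0 c a 0 b 0 0 0
  | .L4_2 => elt c c a 0 0 0 b 0
  | .L5_1 => elt 0 0 a b c 0 0 0

theorem sum_smul_generators (l : Label) (t : Fin 3 → ℂ) :
    ∑ i, t i • generators l i = point l (t 0) (t 1) (t 2) := by
  rw [Fin.sum_univ_three]
  cases l <;>
    simp [generators, point, x₁, x₂, x₃, y₁, y₂, y₃, h₁, h₂, smul_elt, elt_add, elt_sub, mul_comm]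

theorem mem_span_generators_iff {l : Label} {X : Alg} :
    X ∈ Submodule.span ℂ (Set.range (generators l)) ↔ ∃ a b c, point l a b c = X := by
  rw [Submodule.mem_span_range_iff_exists_fun]
  constructor
  · rintro ⟨t, rfl⟩
    exact ⟨_, _, _, (sum_smul_generators l t).symm⟩
  · rintro ⟨a, b, c, rfl⟩
    exact ⟨![a, b, c], sum_smul_generators l ![a, b, c]⟩

/-- The coordinates, with respect to the generators of `subalg l`, of a basis `z₁, z₂, z₃` having
the brackets of the isomorphism type attached to `l`. -/
noncomputable def basisCoords : Label → Matrix (Fin 3) (Fin 3) ℂ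
  | .L2_1 | .L2_2 => !![1, 0, 0; 0, 1, 0; 0, 0, 1 / 3]
  | .L3_quarter_1 => !![1, 0, 0; 1 / 2, 1 / 6, 0; 0, 0, 1 / 6]
  | .L3_quarter_2 => !![0, 1, 0; 1 / 6, 1 / 2, 0; 0, 0, -1 / 6]
  | .L3_two_ninths => !![1, 1, 0; 1 / 3, 2 / 3, 0; 0, 0, 1 / 3]
  | .L3_zero => !![1, 1, 2; 1, 0, 0; 0, 1 / 2, 0]
  | .family₁ α _ _ => !![1, 1, 0; (α - 2) / (3 * (α - 1)), (2 * α - 1) / (3 * (α - 1)), 0;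
      0, 0, 1 / (3 * (α - 1))]
  | .family₂ α _ _ => !![1, 1, 0; (α - 2) / (3 * (α - 1)), (2 * α - 1) / (3 * (α - 1)), 0;
      0, 0, -1 / (3 * (α - 1))]
  | .L4_1 => !![1, 1, 0; -1, 1, 0; 0, 0, 1]
  | .L4_2 => !![1, 1, 0; 1, -1, 0; 0, 0, 1]
  | .L5_1 => !![0, 1, 0; 0, 0, -1; 1, 0, 0]

/-- The basis of `subalg l` with coordinates `basisCoords l`. -/
noncomputable def adaptedBasis (l : Label) (i : Fin 3) : Alg :=
  point l (basisCoords l i 0) (basisCoords l i 1) (basisCoords l i 2)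

/-- The matrix of `ad z₃` on `⟨z₁, z₂⟩` in the isomorphism type attached to `l`. -/
noncomputable def structureMatrix : Label → Matrix (Fin 2) (Fin 2) ℂ
  | .L2_1 | .L2_2 => !![1, 0; 0, 1]
  | .L3_quarter_1 | .L3_quarter_2 => !![0, 1; -(1 / 4), 1]
  | .L3_two_ninths => !![0, 1; -(2 / 9), 1]
  | .L3_zero => !![0, 1; 0, 1]
  | .family₁ α _ _ | .family₂ α _ _ =>
      !![0, 1; -((2 * α - 1) * (α - 2) / (9 * (α - 1) ^ 2)), 1]
  | .L4_1 | .L4_2 => !![0, 1; 1, 0]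
  | .L5_1 => !![0, 1; 0, 0]

theorem hasListedType_of_satisfiesBrackets {T : Type*} [LieRing T] [LieAlgebra ℂ T] {l : Label}
    {b : Module.Basis (Fin 3) ℂ T} (hb : SatisfiesBrackets (structureMatrix l) b) :
    HasListedType T l := by
  obtain ⟨h20, h21, h01⟩ := hb
  cases l <;> exact ⟨b, by simpa [structureMatrix] using h20,
    by simpa [structureMatrix] using h21, h01⟩

theorem satisfiesBrackets_adaptedBasis (l : Label) :
    SatisfiesBrackets (structureMatrix l) (adaptedBasis l) := by
  cases l
  all_goals
    constructor <;>
      simp only [adaptedBasis, basisCoords, structureMatrix, point, of_apply, cons_val, lie_elt,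
        smul_elt, elt_add, ← elt_zero, elt_inj] <;>
      grind

theorem linearIndependent_adaptedBasis (l : Label) : LinearIndependent ℂ (adaptedBasis l) := by
  rw [Fintype.linearIndependent_iff]
  intro t ht
  rw [Fin.sum_univ_three, ← elt_zero] at ht
  suffices t 0 = 0 ∧ t 1 = 0 ∧ t 2 = 0 by simpa [Fin.forall_fin_succ] using this
  cases l <;>
    simp only [adaptedBasis, basisCoords, point, of_apply, cons_val, smul_elt, elt_add,
      elt_inj] at ht <;>
    grind

theorem span_adaptedBasis (l : Label) :
    Submodule.span ℂ (Set.range (adaptedBasis l)) =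
      Submodule.span ℂ (Set.range (generators l)) :=
  span_range_eq_of_linearIndependent (linearIndependent_adaptedBasis l) fun _ ↦
    mem_span_generators_iff.2 ⟨_, _, _, rfl⟩

theorem toSubmodule_subalg (l : Label) :
    (subalg l).toSubmodule = Submodule.span ℂ (Set.range (generators l)) := by
  rw [subalg_eq_lieSpan,
    (satisfiesBrackets_adaptedBasis l).coe_lieSpan_eq_span (span_adaptedBasis l)]

theorem mem_subalg_iff {l : Label} {X : Alg} : X ∈ subalg l ↔ ∃ a b c, point l a b c = X := by
  rw [← LieSubalgebra.mem_toSubmodule, toSubmodule_subalg, mem_span_generators_iff]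

theorem exists_basis_subalg (l : Label) :
    ∃ b : Module.Basis (Fin 3) ℂ (subalg l), SatisfiesBrackets (structureMatrix l) b :=
  (satisfiesBrackets_adaptedBasis l).exists_basis (linearIndependent_adaptedBasis l)
    ((span_adaptedBasis l).trans (toSubmodule_subalg l).symm)

theorem finrank_subalg (l : Label) : Module.finrank ℂ (subalg l) = 3 := by
  obtain ⟨b, -⟩ := exists_basis_subalg l
  rw [Module.finrank_eq_card_basis b, Fintype.card_fin]

theorem isSolvable_subalg (l : Label) : LieAlgebra.IsSolvable (subalg l) := by
  obtain ⟨b, hb⟩ := exists_basis_subalg l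
  exact hb.isSolvable

theorem hasListedType_subalg (l : Label) : HasListedType (subalg l) l := by
  obtain ⟨b, hb⟩ := exists_basis_subalg l
  exact hasListedType_of_satisfiesBrackets hb

theorem innerEquivalent_subalg_of_generators {K : LieSubalgebra ℂ Alg} {l : Label}
    (hK : Module.finrank ℂ K = 3) (P : GL (Fin 3) ℂ)
    (h : ∀ i, ∃ X ∈ K, (P : Matrix (Fin 3) (Fin 3) ℂ) * X = generators l i * P) :
    InnerEquivalent K (subalg l) := by
  refine innerEquivalent_iff_exists_slConj.2 ⟨P, (LieSubalgebra.toSubmodule_injective ?_).symm⟩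
  refine Submodule.eq_of_le_of_finrank_eq ?_ ?_
  · rw [toSubmodule_subalg, Submodule.span_le]
    rintro _ ⟨i, rfl⟩
    obtain ⟨X, hX, hP⟩ := h i
    exact ⟨X, hX, slConj_eq_iff.2 hP⟩
  · exact (finrank_subalg l).trans
      (hK.symm.trans (finrank_map_lieEquiv K _).symm)

/-- The transposed label: `X ↦ -Xᵀ` carries `subalg l` to a subalgebra equivalent to
`subalg l.dual`. -/
def Label.dual : Label → Label
  | .L2_1 => .L2_2
  | .L2_2 => .L2_1
  | .L3_quarter_1 => .L3_quarter_2
  | .L3_quarter_2 => .L3_quarter_1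
  | .L3_two_ninths => .L3_two_ninths
  | .L3_zero => .L3_zero
  | .family₁ α h1 h2 => .family₂ α h1 h2
  | .family₂ α h1 h2 => .family₁ α h1 h2
  | .L4_1 => .L4_2
  | .L4_2 => .L4_1
  | .L5_1 => .L5_1

/-- Coordinates of elements of `subalg l` that are carried to the generators of `subalg l.dual` by
`X ↦ -Xᵀ` followed by conjugation with a permutation matrix. -/
def dualCoords : Label → Matrix (Fin 3) (Fin 3) ℂ
  | .L2_1 | .L2_2 => !![-1, 0, 0; 0, 1, 0; 0, 0, 1]
  | .L3_quarter_1 | .L3_quarter_2 => !![0, 1, 0; 1, 0, 0; 0, 0, -1]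
  | .L3_two_ninths => !![-1, 0, 0; 0, -1, 0; 0, 0, 1]
  | .L3_zero => !![-1, 0, 0; 0, 1, 0; 0, -1, -1]
  | .family₁ _ _ _ | .family₂ _ _ _ | .L4_1 | .L4_2 => !![-1, 0, 0; 0, 1, 0; 0, 0, -1]
  | .L5_1 => !![0, -1, 0; -1, 0, 0; 0, 0, -1]

/-- The permutation matrix used together with `dualCoords`. -/
def dualizer : Label → Matrix (Fin 3) (Fin 3) ℂ
  | .L3_quarter_1 | .L3_quarter_2 => !![1, 0, 0; 0, 0, 1; 0, 1, 0]
  | .L3_two_ninths | .L5_1 => !![0, 0, 1; 0, 1, 0; 1, 0, 0]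
  | _ => !![0, 1, 0; 1, 0, 0; 0, 0, 1]

theorem dualizer_mul_dualizer (l : Label) : dualizer l * dualizer l = 1 := by
  cases l <;> simp [dualizer, one_fin_three]

theorem dualizer_mul_slNegTranspose_point (l : Label) (i : Fin 3) :
    dualizer l * (slNegTranspose (Fin 3) ℂ
        (point l (dualCoords l i 0) (dualCoords l i 1) (dualCoords l i 2))).val =
      (generators l.dual i).val * dualizer l := by
  cases l <;> fin_cases i <;>
    simp [Label.dual, dualizer, dualCoords, generators, point, x₁, x₂, x₃, y₁, y₂, y₃, h₁, h₂,
      smul_elt, elt_add, elt_sub, slNegTranspose_elt, coe_elt] <;>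
    grind

theorem innerEquivalent_map_slNegTranspose (l : Label) :
    InnerEquivalent ((subalg l).map (slNegTranspose (Fin 3) ℂ : Alg →ₗ⁅ℂ⁆ Alg))
      (subalg l.dual) := by
  refine innerEquivalent_subalg_of_generators ?_ ⟨dualizer l, dualizer l, dualizer_mul_dualizer l,
    dualizer_mul_dualizer l⟩ fun i ↦ ⟨_, ?_, dualizer_mul_slNegTranspose_point l i⟩
  · exact (finrank_map_lieEquiv (subalg l) _).trans (finrank_subalg l)
  · exact ⟨_, mem_subalg_iff.2 ⟨_, _, _, rfl⟩, rfl⟩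

theorem innerEquivalent_dual {l l' : Label} (h : InnerEquivalent (subalg l) (subalg l')) :
    InnerEquivalent (subalg l.dual) (subalg l'.dual) :=
  (innerEquivalent_map_slNegTranspose l).symm.trans <|
    (h.map (slNegTranspose (Fin 3) ℂ)).trans (innerEquivalent_map_slNegTranspose l')

end A2

theorem InnerEquivalent.forall_mem_iff {n : Type*} [Fintype n] [DecidableEq n]
    {K K' : LieSubalgebra ℂ (sl n ℂ)} (h : InnerEquivalent K K') {p : Matrix n n ℂ → Prop}
    (hp : ∀ (P : GL n ℂ) X Y, SemiconjBy (P : Matrix n n ℂ) X Y → (p X ↔ p Y)) :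
    (∀ X ∈ K, p X) ↔ ∀ Y ∈ K', p Y := by
  obtain ⟨P, rfl⟩ := innerEquivalent_iff_exists_slConj.1 h
  have key (X : sl n ℂ) : p X ↔ p (slConj P X) := hp P _ _ (slConj_eq_iff.1 rfl)
  exact ⟨fun hK ↦ by rintro _ ⟨X, hX, rfl⟩; exact (key X).1 (hK X hX),
    fun hK X hX ↦ (key X).2 (hK _ ⟨X, hX, rfl⟩)⟩

theorem eq_zero_iff_of_semiconjBy_units {M : Type*} [MonoidWithZero M] {P : Mˣ} {X Y : M}
    (h : SemiconjBy (P : M) X Y) : X = 0 ↔ Y = 0 := by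
  rw [← P.mul_right_eq_zero, h.eq, P.mul_left_eq_zero]

namespace A2

section Invariants

variable {l l' : Label} {K K' : LieSubalgebra ℂ Alg} {α β : ℂ}

theorem forall_pow_three_eq_zero_iff :
    (∀ X ∈ subalg l, (X : Matrix (Fin 3) (Fin 3) ℂ) ^ 3 = 0) ↔ l = .L5_1 := by
  constructor
  · intro h
    have h' := h (point l 0 0 1) (mem_subalg_iff.2 ⟨_, _, _, rfl⟩)
    have h'' := h (point l 0 1 0) (mem_subalg_iff.2 ⟨_, _, _, rfl⟩)
    cases l <;>
      simp [point, coe_elt, pow_three, ← Matrix.ext_iff, Fin.forall_fin_succ] at h' h'' ⊢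
  · rintro rfl X hX
    obtain ⟨a, b, c, rfl⟩ := mem_subalg_iff.1 hX
    simp [point, coe_elt, pow_three, ← Matrix.ext_iff, Fin.forall_fin_succ]

theorem forall_sq_eq_zero_of_pow_three_eq_zero_iff :
    (∀ X ∈ subalg l, (X : Matrix (Fin 3) (Fin 3) ℂ) ^ 3 = 0 →
      (X : Matrix (Fin 3) (Fin 3) ℂ) ^ 2 = 0) ↔ l ≠ .L3_two_ninths ∧ l ≠ .L5_1 := by
  constructor
  · intro h
    constructor
    · rintro rfl
      have := h (point .L3_two_ninths 1 0 0) (mem_subalg_iff.2 ⟨_, _, _, rfl⟩)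
      simp [point, coe_elt, pow_succ, ← Matrix.ext_iff, Fin.forall_fin_succ] at this
    · rintro rfl
      have := h (point .L5_1 1 1 0) (mem_subalg_iff.2 ⟨_, _, _, rfl⟩)
      simp [point, coe_elt, pow_succ, ← Matrix.ext_iff, Fin.forall_fin_succ] at this
  · rintro h X hX
    obtain ⟨a, b, c, rfl⟩ := mem_subalg_iff.1 hX
    cases l <;>
      simp [point, coe_elt, pow_succ, ← Matrix.ext_iff, Fin.forall_fin_succ] at h ⊢ <;> grind

theorem forall_exists_sq_eq_iff :
    (∀ X ∈ subalg l, ∃ s t : ℂ, (X : Matrix (Fin 3) (Fin 3) ℂ) ^ 2 = s • X.val + t • 1) ↔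
      l = .L2_1 ∨ l = .L2_2 := by
  constructor
  · intro h
    obtain ⟨s, t, hst⟩ := h (point l 1 1 1) (mem_subalg_iff.2 ⟨_, _, _, rfl⟩)
    cases l <;> simp [point, coe_elt, pow_two, one_fin_three] at hst ⊢ <;> grind
  · rintro (rfl | rfl) X hX <;> obtain ⟨a, b, c, rfl⟩ := mem_subalg_iff.1 hX
    · refine ⟨c, 2 * c ^ 2, ?_⟩
      simp [point, coe_elt, pow_two, one_fin_three]
      grind
    · refine ⟨-c, 2 * c ^ 2, ?_⟩
      simp [point, coe_elt, pow_two, one_fin_three]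
      grind

/-- `v` spans the image of every nilpotent element of `K`, and every `Y ∈ K` with diagonal part
proportional to `diag(α - 1, 1, -α)` in a suitable order has eigenvalue `α - 1` on `v`, up to the
same factor. The latter is expressed through the ratio of the squared eigenvalue to `tr Y²`. -/
def HasImageLine (K : LieSubalgebra ℂ Alg) (α : ℂ) : Prop :=
  ∃ v ≠ 0, ∀ X ∈ K, (X.val ^ 3 = 0 → ∀ w, ∃ d : ℂ, X.val *ᵥ w = d • v) ∧
    ∃ c : ℂ, X.val *ᵥ v = c • v ∧
      (α - 1) ^ 2 * trace (X.val * X.val) = 2 * (α ^ 2 - α + 1) * c ^ 2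

theorem HasImageLine.of_innerEquivalent (hK : HasImageLine K α) (h : InnerEquivalent K K') :
    HasImageLine K' α := by
  obtain ⟨v, hv, hK⟩ := hK
  obtain ⟨P, rfl⟩ := innerEquivalent_iff_exists_slConj.1 h
  refine ⟨P.val *ᵥ v, fun h0 ↦ hv (mulVec_injective_of_isUnit P.isUnit (by simpa using h0)), ?_⟩
  rintro Y ⟨X, hX, hXY⟩
  have hP : SemiconjBy P.val X.val Y.val := slConj_eq_iff.1 hXY
  have hPv (w : Fin 3 → ℂ) : Y.val *ᵥ (P.val *ᵥ w) = P.val *ᵥ (X.val *ᵥ w) := by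
    rw [mulVec_mulVec, mulVec_mulVec, hP.eq]
  obtain ⟨hline, c, hc, htr⟩ := hK X hX
  refine ⟨fun hY w ↦ ?_, c, by rw [hPv, hc, mulVec_smul], ?_⟩
  · obtain ⟨d, hd⟩ :=
      hline ((eq_zero_iff_of_semiconjBy_units (hP.pow_right 3)).2 hY) (P⁻¹.val *ᵥ w)
    refine ⟨d, ?_⟩
    rw [← mulVec_smul, ← hd, ← hPv, mulVec_mulVec w, Units.mul_inv, one_mulVec]
  · rw [← htr, (Units.eq_mul_inv_iff_mul_eq P).2 (hP.mul_right hP).eq.symm, trace_units_conj]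

/-- The parameter `α` of the image line of `subalg l`, if it has one. -/
noncomputable def imageParam : Label → Option ℂ
  | .L2_1 | .L3_quarter_1 => some (-1)
  | .family₁ α _ _ => some α
  | .L4_1 => some 1
  | _ => none

variable {a b c d e f g h : ℂ}

theorem elt_mulVec {v : Fin 3 → ℂ} :
    (elt a b c d e f g h).val *ᵥ v =
      ![a * v 0 + c * v 1 - e * v 2, f * v 0 + (b - a) * v 1 + d * v 2,
        -h * v 0 + g * v 1 - b * v 2] := by
  ext i
  fin_cases i <;> simp [coe_elt, mulVec, dotProduct, Fin.sum_univ_three] <;> ring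

theorem trace_elt_mul_elt :
    trace ((elt a b c d e f g h).val * (elt a b c d e f g h).val) =
      a ^ 2 + (b - a) ^ 2 + b ^ 2 + 2 * (c * f + d * g + e * h) := by
  simp [coe_elt, trace_fin_three]
  ring

theorem hasImageLine_of_imageParam (hl : imageParam l = some α) : HasImageLine (subalg l) α := by
  refine ⟨![1, 0, 0], by simp, fun X hX ↦ ?_⟩
  obtain ⟨a, b, c, rfl⟩ := mem_subalg_iff.1 hX
  have hc (h : (point l a b c).val ^ 3 = 0) : c = 0 := by
    have h11 := congrFun₂ h 1 1
    cases l <;> simp [imageParam] at hl <;> simp [point, coe_elt, pow_three] at h11 <;> grind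
  refine ⟨fun hX w ↦ ⟨a * w 1 - b * w 2, ?_⟩, (point l a b c).val 0 0, ?_⟩
  · rw [hc hX]
    cases l <;> simp [imageParam] at hl <;> simp [point, elt_mulVec]
  · cases l <;> simp [imageParam] at hl <;> simp only [point, elt_mulVec, trace_elt_mul_elt] <;>
      simp [coe_elt] <;> grind

theorem eq_or_mul_eq_one_of_ratio_eq
    (h : (β - 1) ^ 2 * ((α - 1) ^ 2 + 1 + α ^ 2) = 2 * (β ^ 2 - β + 1) * (α - 1) ^ 2) :
    α = β ∨ α * β = 1 := by
  have hαβ : (α - β) * (α * β - 1) = 0 := by linear_combination -h / 2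
  rcases mul_eq_zero.1 hαβ with h | h
  exacts [.inl (sub_eq_zero.1 h), .inr (sub_eq_zero.1 h)]

theorem exists_imageParam_of_hasImageLine (hl : HasImageLine (subalg l) β) :
    ∃ α, imageParam l = some α ∧ (α = β ∨ α * β = 1) := by
  obtain ⟨v, hv, hl⟩ := hl
  obtain ⟨n₀, -⟩ := hl (point l 1 0 0) (mem_subalg_iff.2 ⟨_, _, _, rfl⟩)
  obtain ⟨n₁, c₁, e₁⟩ := hl (point l 0 1 0) (mem_subalg_iff.2 ⟨_, _, _, rfl⟩)
  obtain ⟨-, c₂, e₂⟩ := hl (point l 0 0 1) (mem_subalg_iff.2 ⟨_, _, _, rfl⟩)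
  replace n₀ h := n₀ h ![1, 1, 1]
  replace n₁ h := n₁ h ![1, 1, 1]
  clear hl
  rw [Ne, funext_iff, Fin.forall_fin_succ] at hv
  cases l <;>
    simp only [imageParam, Option.some.injEq, exists_eq_left', point, elt_mulVec,
      trace_elt_mul_elt] at n₀ n₁ e₁ e₂ ⊢ <;>
    simp [coe_elt, pow_three, ← Matrix.ext_iff, funext_iff, Fin.forall_fin_succ] at hv n₀ n₁ e₁ e₂
  case family₁ α _ _ =>
    obtain rfl : c₂ = α - 1 := by grind
    exact eq_or_mul_eq_one_of_ratio_eq (by grind)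
  all_goals grind

theorem imageParam_of_innerEquivalent (h : InnerEquivalent (subalg l) (subalg l'))
    (hl : imageParam l = some α) :
    ∃ β, imageParam l' = some β ∧ (β = α ∨ β * α = 1) :=
  exists_imageParam_of_hasImageLine ((hasImageLine_of_imageParam hl).of_innerEquivalent h)

theorem eq_or_family_of_innerEquivalent (h : InnerEquivalent (subalg l) (subalg l')) :
    l = l' ∨
      (∃ α hα₁ hα₂ β hβ₁ hβ₂, l = .family₁ α hα₁ hα₂ ∧ l' = .family₁ β hβ₁ hβ₂) ∨
      (∃ α hα₁ hα₂ β hβ₁ hβ₂, l = .family₂ α hα₁ hα₂ ∧ l' = .family₂ β hβ₁ hβ₂) := by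
  have hnil := h.forall_mem_iff (p := fun X ↦ X ^ 3 = 0) fun P X Y hP ↦
    eq_zero_iff_of_semiconjBy_units (hP.pow_right 3)
  have hsq := h.forall_mem_iff (p := fun X ↦ X ^ 3 = 0 → X ^ 2 = 0) fun P X Y hP ↦
    imp_congr (eq_zero_iff_of_semiconjBy_units (hP.pow_right 3))
      (eq_zero_iff_of_semiconjBy_units (hP.pow_right 2))
  have hquad := h.forall_mem_iff (p := fun X ↦ ∃ s t : ℂ, X ^ 2 = s • X + t • 1) fun P X Y hP ↦
    exists₂_congr fun s t ↦ by
      rw [← sub_eq_zero, ← sub_eq_zero (a := Y ^ 2)]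
      exact eq_zero_iff_of_semiconjBy_units <| (hP.pow_right 2).sub_right <|
        (hP.smul_right s).add_right ((SemiconjBy.one_right _).smul_right t)
  rw [forall_pow_three_eq_zero_iff, forall_pow_three_eq_zero_iff] at hnil
  rw [forall_sq_eq_zero_of_pow_three_eq_zero_iff, forall_sq_eq_zero_of_pow_three_eq_zero_iff] at hsq
  rw [forall_exists_sq_eq_iff, forall_exists_sq_eq_iff] at hquad
  have himage (α) := imageParam_of_innerEquivalent (α := α) h
  have himage' (α) := imageParam_of_innerEquivalent (α := α) h.symm
  have hdual (α) := imageParam_of_innerEquivalent (α := α) (innerEquivalent_dual h)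
  have hdual' (α) := imageParam_of_innerEquivalent (α := α) (innerEquivalent_dual h).symm
  clear h
  cases l <;> cases l' <;> simp [imageParam, Label.dual] at * <;> grind

end Invariants

/-- The permutation matrix exchanging the second and third basis vectors. -/
def swap : GL (Fin 3) ℂ :=
  ⟨!![1, 0, 0; 0, 0, 1; 0, 1, 0], !![1, 0, 0; 0, 0, 1; 0, 1, 0], by simp [one_fin_three],
    by simp [one_fin_three]⟩

section Families

variable {α β : ℂ} {hα₁ : α ≠ 1} {hα₂ : α ≠ -1} {hβ₁ : β ≠ 1} {hβ₂ : β ≠ -1}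

theorem innerEquivalent_family₁_of_mul_eq_one (h : α * β = 1) :
    InnerEquivalent (subalg (.family₁ α hα₁ hα₂)) (subalg (.family₁ β hβ₁ hβ₂)) := by
  refine innerEquivalent_subalg_of_generators (finrank_subalg _) swap fun i ↦
    ⟨point (.family₁ α hα₁ hα₂) (![0, -1, 0] i) (![-1, 0, 0] i) (![0, 0, -β] i),
      mem_subalg_iff.2 ⟨_, _, _, rfl⟩, ?_⟩
  fin_cases i <;>
    simp [swap, generators, point, x₁, x₃, h₁, h₂, smul_elt, elt_add, coe_elt]
  grind

theorem innerEquivalent_family₁_iff :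
    InnerEquivalent (subalg (.family₁ α hα₁ hα₂)) (subalg (.family₁ β hβ₁ hβ₂)) ↔
      α = β ∨ α * β = 1 := by
  refine ⟨fun h ↦ ?_, ?_⟩
  · obtain ⟨γ, hγ, h⟩ := imageParam_of_innerEquivalent h.symm rfl
    cases hγ
    exact h
  · rintro (rfl | h)
    exacts [.refl _, innerEquivalent_family₁_of_mul_eq_one h]

theorem innerEquivalent_family₂_iff :
    InnerEquivalent (subalg (.family₂ α hα₁ hα₂)) (subalg (.family₂ β hβ₁ hβ₂)) ↔
      α = β ∨ α * β = 1 :=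
  Iff.trans ⟨innerEquivalent_dual, innerEquivalent_dual⟩ innerEquivalent_family₁_iff

end Families

end A2

section Triangularization

variable (k L V : Type*) [Field k] [CharZero k] [IsAlgClosed k] [LieRing L] [LieAlgebra k L]
  [LieAlgebra.IsSolvable L] [AddCommGroup V] [Module k V] [Module.Finite k V] [LieRingModule L V]
  [LieModule k L V]

theorem exists_dual_ne_zero_forall_lie_eq_smul [Nontrivial V] :
    ∃ (f : Module.Dual k V) (χ : L → k), f ≠ 0 ∧ ∀ x v, f ⁅x, v⁆ = χ x * f v := by
  obtain ⟨χ, hχ⟩ := LieModule.exists_nontrivial_weightSpace_of_isSolvable k L (Module.Dual k V)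
  obtain ⟨⟨f, hf⟩, hf0⟩ := exists_ne (0 : LieModule.weightSpace (Module.Dual k V) χ)
  rw [LieModule.mem_weightSpace] at hf
  refine ⟨f, fun x ↦ -χ x, fun h ↦ hf0 (Subtype.ext h), fun x v ↦ ?_⟩
  have := LinearMap.congr_fun (hf x) v
  rw [Module.Dual.lie_apply, LinearMap.smul_apply, smul_eq_mul] at this
  rw [neg_mul, ← this, neg_neg]

theorem exists_basis_forall_lie_mem_span_Iic {n : ℕ} (hn : Module.finrank k V = n) :
    ∃ b : Module.Basis (Fin n) k V,
      ∀ (x : L) (j : Fin n), ⁅x, b j⁆ ∈ Submodule.span k (b '' Set.Iic j) := by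
  induction n generalizing V with
  | zero => exact ⟨Module.finBasisOfFinrankEq k V hn, fun _ j ↦ j.elim0⟩
  | succ n ih =>
    have : Nontrivial V := Module.nontrivial_of_finrank_pos (R := k) (by lia)
    obtain ⟨f, χ, hf0, hf⟩ := exists_dual_ne_zero_forall_lie_eq_smul k L V
    let N : LieSubmodule k L V :=
      { LinearMap.ker f with
        lie_mem := fun {x v} (hv : f v = 0) ↦ show f ⁅x, v⁆ = 0 by rw [hf, hv, mul_zero] }
    have hN : Module.finrank k N = n := by
      have h : Module.finrank k N + 1 = _ := Module.Dual.finrank_ker_add_one_of_ne_zero hf0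
      lia
    obtain ⟨b, hb⟩ := ih N hN
    obtain ⟨y, hy⟩ : ∃ y, f y = 1 := (LinearMap.surjective hf0) 1
    let B : Module.Basis (Fin (n + 1)) k V := .mkFinSnoc (N := LinearMap.ker f) b y
      (fun c x (hx : f x = 0) h ↦ by simpa [hx, hy] using congrArg f h)
      (fun z ↦ ⟨-f z, by simp [hy]⟩)
    have hB : ⇑B = Fin.snoc ((↑) ∘ b) y := Module.Basis.coe_mkFinSnoc ..
    refine ⟨B, fun x ↦ Fin.lastCases ?_ fun j ↦ ?_⟩
    · rw [show Set.Iic (Fin.last n) = Set.univ from Set.Iic_top, Set.image_univ, B.span_eq]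
      trivial
    · have h := Submodule.mem_map_of_mem (f := N.toSubmodule.subtype) (hb x j)
      rw [Submodule.map_span] at h
      rw [hB, Fin.snoc_castSucc]
      refine Submodule.span_mono ?_ h
      rintro _ ⟨_, ⟨i, hi, rfl⟩, rfl⟩
      exact ⟨i.castSucc, Fin.castSucc_le_castSucc_iff.2 hi, by simp⟩

end Triangularization

theorem exists_forall_map_slConj_blockTriangular {k : Type*} [Field k] [CharZero k]
    [IsAlgClosed k] {n : ℕ} (K : LieSubalgebra k (sl (Fin n) k)) [LieAlgebra.IsSolvable K] :
    ∃ P : GL (Fin n) k, ∀ X ∈ K.map (slConj P : sl (Fin n) k →ₗ⁅k⁆ sl (Fin n) k),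
      (X : Matrix (Fin n) (Fin n) k).BlockTriangular id := by
  obtain ⟨b, hb⟩ := exists_basis_forall_lie_mem_span_Iic k K (Fin n → k) (Module.finrank_fin_fun k)
  let e := Pi.basisFun k (Fin n)
  refine ⟨⟨b.toMatrix e, e.toMatrix b, b.toMatrix_mul_toMatrix_flip e,
    e.toMatrix_mul_toMatrix_flip b⟩, ?_⟩
  rintro _ ⟨X, hX, rfl⟩ i j hij
  have hconj : b.toMatrix e * X.val * e.toMatrix b = LinearMap.toMatrix b b X.val.toLin' := by
    rw [← basis_toMatrix_mul_linearMap_toMatrix_mul_basis_toMatrix (c' := e) (b' := e),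
      LinearMap.toMatrix_eq_toMatrix', LinearMap.toMatrix'_toLin']
  change (b.toMatrix e * X.val * e.toMatrix b) i j = 0
  rw [hconj, LinearMap.toMatrix_apply]
  exact Finsupp.notMem_support_iff.1 fun hi ↦
    hij.not_ge (b.mem_span_image.1 (hb ⟨X, hX⟩ j) hi)

theorem mem_map_slConj_of_mul_eq {n R : Type*} [Fintype n] [DecidableEq n] [CommRing R]
    {K : LieSubalgebra R (sl n R)} {P : GL n R} {X Y : sl n R} (hX : X ∈ K)
    (h : (P : Matrix n n R) * X = Y * P) : Y ∈ K.map (slConj P : sl n R →ₗ⁅R⁆ sl n R) :=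
  ⟨X, hX, slConj_eq_iff.2 h⟩

theorem slNegTranspose_slNegTranspose {n R : Type*} [Fintype n] [DecidableEq n] [CommRing R]
    (X : sl n R) : slNegTranspose n R (slNegTranspose n R X) = X :=
  (slNegTranspose n R).left_inv X

namespace A2

/-- `K` is equivalent to a member of the list. -/
def IsListed (K : LieSubalgebra ℂ Alg) : Prop := ∃ l, InnerEquivalent K (subalg l)

section Classification

variable {K : LieSubalgebra ℂ Alg} {a b c d e c' d' e' p q r : ℂ}

theorem IsListed.of_map_slConj {P : GL (Fin 3) ℂ}
    (h : IsListed (K.map (slConj P : Alg →ₗ⁅ℂ⁆ Alg))) : IsListed K := by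
  obtain ⟨l, h⟩ := h
  exact ⟨l, .trans (innerEquivalent_iff_exists_slConj.2 ⟨P, rfl⟩) h⟩

theorem IsListed.of_map_slNegTranspose
    (h : IsListed (K.map (slNegTranspose (Fin 3) ℂ : Alg →ₗ⁅ℂ⁆ Alg))) : IsListed K := by
  obtain ⟨l, h⟩ := h
  refine ⟨l.dual, .trans ?_ (innerEquivalent_map_slNegTranspose l)⟩
  convert h.map (slNegTranspose (Fin 3) ℂ)
  ext X
  refine ⟨fun hX ↦ ⟨_, ⟨X, hX, rfl⟩, slNegTranspose_slNegTranspose X⟩, ?_⟩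
  rintro ⟨_, ⟨Y, hY, rfl⟩, rfl⟩
  exact (slNegTranspose_slNegTranspose Y).symm ▸ hY

theorem isListed_of_generators_mem (hK : Module.finrank ℂ K = 3) (l : Label)
    (h0 : generators l 0 ∈ K) (h1 : generators l 1 ∈ K) (h2 : generators l 2 ∈ K) : IsListed K :=
  ⟨l, innerEquivalent_subalg_of_generators hK 1 fun i ↦ ⟨generators l i, by
    fin_cases i <;> assumption, by simp⟩⟩

theorem isListed_of_x₁_mem_of_x₃_mem_of_diagonal_mem (hK : Module.finrank ℂ K = 3) (hx₁ : x₁ ∈ K)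
    (hx₃ : x₃ ∈ K) (h : elt a b 0 0 0 0 0 0 ∈ K) (hab : a ≠ 0 ∨ b ≠ 0) : IsListed K := by
  by_cases hL₂ : a = 2 * b
  · refine isListed_of_generators_mem hK .L2_1 hx₁ hx₃ ?_
    convert K.smul_mem b⁻¹ h using 1
    simp [generators, h₁, h₂, smul_elt, elt_add, elt_inj]
    grind
  by_cases hL₄ : a = 0
  · refine isListed_of_generators_mem hK .L4_1 hx₁ hx₃ ?_
    convert K.smul_mem b⁻¹ h using 1
    simp [generators, h₂, smul_elt, elt_inj]
    grind
  by_cases hα : a = b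
  · refine IsListed.of_map_slConj (P := swap) <| isListed_of_generators_mem
      ((finrank_map_lieEquiv K _).trans hK) (.family₁ 0 zero_ne_one (by simp))
      (mem_map_slConj_of_mul_eq (K.neg_mem hx₃) ?_) (mem_map_slConj_of_mul_eq (K.neg_mem hx₁) ?_)
      (mem_map_slConj_of_mul_eq (K.smul_mem (-a⁻¹) h) ?_)
    all_goals simp [swap, generators, x₁, x₃, h₁, smul_elt, coe_elt] <;> grind
  · refine isListed_of_generators_mem hK (.family₁ (b / (b - a)) (by grind) (by grind)) hx₁ hx₃ ?_
    convert K.smul_mem (b - a)⁻¹ h using 1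
    simp [generators, h₁, h₂, smul_elt, elt_add, elt_inj]
    grind

theorem isListed_of_x₁_mem_of_x₃_mem (hK : Module.finrank ℂ K = 3) (hx₁ : x₁ ∈ K) (hx₃ : x₃ ∈ K)
    (h : elt a b 0 d 0 0 0 0 ∈ K) (hab : a ≠ 0 ∨ b ≠ 0) : IsListed K := by
  by_cases hd : d = 0
  · exact isListed_of_x₁_mem_of_x₃_mem_of_diagonal_mem hK hx₁ hx₃ (hd ▸ h) hab
  by_cases hL₃ : a = 2 * b
  · have hb : b ≠ 0 := by grind
    let P := GeneralLinearGroup.mkOfDetNeZero !![b, 0, 0; 0, b, 0; 0, 0, d]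
      (by simp [det_fin_three, hb, hd])
    refine IsListed.of_map_slConj (P := P) <| isListed_of_generators_mem
      ((finrank_map_lieEquiv K _).trans hK) .L3_quarter_1 (mem_map_slConj_of_mul_eq hx₁ ?_)
      (mem_map_slConj_of_mul_eq (K.smul_mem (d / b) hx₃) ?_)
      (mem_map_slConj_of_mul_eq (K.smul_mem b⁻¹ h) ?_)
    all_goals
      simp [P, GeneralLinearGroup.mkOfDetNeZero, generators, x₁, x₂, x₃, h₁, h₂, smul_elt, elt_add,
        coe_elt] <;> grind
  · let P := GeneralLinearGroup.mkOfDetNeZero !![1, 0, 0; 0, 1, d / (2 * b - a); 0, 0, 1]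
      (by simp [det_fin_three])
    refine IsListed.of_map_slConj (P := P) <| isListed_of_x₁_mem_of_x₃_mem_of_diagonal_mem
      (a := a) (b := b) ((finrank_map_lieEquiv K _).trans hK) (mem_map_slConj_of_mul_eq
        (K.sub_mem hx₁ (K.smul_mem (d / (2 * b - a)) hx₃)) ?_)
      (mem_map_slConj_of_mul_eq hx₃ ?_) (mem_map_slConj_of_mul_eq h ?_) hab
    all_goals
      simp [P, GeneralLinearGroup.mkOfDetNeZero, x₁, x₃, smul_elt, coe_elt] <;> grind

/-- The permutation matrix exchanging the first and third basis vectors. -/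
def reversal : GL (Fin 3) ℂ :=
  ⟨!![0, 0, 1; 0, 1, 0; 1, 0, 0], !![0, 0, 1; 0, 1, 0; 1, 0, 0], by simp [one_fin_three],
    by simp [one_fin_three]⟩

theorem isListed_of_x₂_mem_of_x₃_mem (hK : Module.finrank ℂ K = 3) (hx₂ : x₂ ∈ K) (hx₃ : x₃ ∈ K)
    (h : elt a b c 0 0 0 0 0 ∈ K) (hab : a ≠ 0 ∨ b ≠ 0) : IsListed K := by
  refine .of_map_slNegTranspose <| .of_map_slConj (P := reversal) <|
    isListed_of_x₁_mem_of_x₃_mem (a := b) (b := a) (d := -c)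
      ((finrank_map_lieEquiv _ _).trans ((finrank_map_lieEquiv K _).trans hK))
      (mem_map_slConj_of_mul_eq ⟨-x₂, K.neg_mem hx₂, rfl⟩ ?_)
      (mem_map_slConj_of_mul_eq ⟨-x₃, K.neg_mem hx₃, rfl⟩ ?_)
      (mem_map_slConj_of_mul_eq ⟨_, h, rfl⟩ ?_) hab.symm
  all_goals simp [reversal, x₁, x₂, x₃, slNegTranspose_elt, coe_elt, sub_eq_add_neg, add_comm]

theorem isListed_of_x₁_add_x₂_mem (hK : Module.finrank ℂ K = 3) (hx₃ : x₃ ∈ K) (hp : p ≠ 0)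
    (hq : q ≠ 0) (hpq : elt 0 0 p q 0 0 0 0 ∈ K) (ha : a ≠ 0) (h : elt a a c d 0 0 0 0 ∈ K) :
    IsListed K := by
  let u := (c - d / q * p) / (p * a)
  let P := GeneralLinearGroup.mkOfDetNeZero !![p⁻¹, u, 0; 0, 1, 0; 0, 0, q]
    (by simp [det_fin_three, hp, hq])
  refine .of_map_slConj (P := P) <| isListed_of_generators_mem
    ((finrank_map_lieEquiv K _).trans hK) .L3_two_ninths
    (mem_map_slConj_of_mul_eq (K.add_mem hpq (K.smul_mem (u * p * q) hx₃)) ?_)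
    (mem_map_slConj_of_mul_eq (K.smul_mem (p * q) hx₃) ?_)
    (mem_map_slConj_of_mul_eq (K.smul_mem a⁻¹ (K.sub_mem h (K.smul_mem (d / q) hpq))) ?_)
  all_goals
    simp [P, u, GeneralLinearGroup.mkOfDetNeZero, generators, x₁, x₂, x₃, h₁, h₂, smul_elt,
      elt_add, elt_sub, coe_elt]
    grind

theorem isListed_of_x₃_mem (hK : Module.finrank ℂ K = 3) (hx₃ : x₃ ∈ K)
    (hpq : elt 0 0 p q 0 0 0 0 ∈ K) (hpq0 : p ≠ 0 ∨ q ≠ 0) (h : elt a b c d 0 0 0 0 ∈ K)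
    (hab : a ≠ 0 ∨ b ≠ 0) : IsListed K := by
  rcases eq_or_ne p 0 with rfl | hp
  · have hq : q ≠ 0 := by simpa using hpq0
    refine isListed_of_x₂_mem_of_x₃_mem (a := a) (b := b) (c := c) hK ?_ hx₃ ?_ hab
    · simpa [x₂, smul_elt, hq] using K.smul_mem q⁻¹ hpq
    · simpa [smul_elt, elt_sub, hq] using K.sub_mem h (K.smul_mem (d / q) hpq)
  rcases eq_or_ne q 0 with rfl | hq
  · refine isListed_of_x₁_mem_of_x₃_mem (a := a) (b := b) (d := d) hK ?_ hx₃ ?_ hab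
    · simpa [x₁, smul_elt, hp] using K.smul_mem p⁻¹ hpq
    · simpa [smul_elt, elt_sub, hp] using K.sub_mem h (K.smul_mem (c / p) hpq)
  rcases eq_or_ne a b with rfl | hab'
  · exact isListed_of_x₁_add_x₂_mem hK hx₃ hp hq hpq (by simpa using hab) h
  · have hlie : elt 0 0 ((2 * a - b) * p) ((2 * b - a) * q) 0 0 0 0 ∈ K := by
      convert K.sub_mem (K.lie_mem h hpq) (K.smul_mem (d * p - c * q) hx₃) using 1
      simp only [x₃, lie_elt, smul_elt, elt_sub, elt_inj]
      grind
    refine isListed_of_generators_mem hK .L5_1 ?_ ?_ hx₃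
    · convert K.smul_mem (3 * (a - b) * p)⁻¹ (K.sub_mem hlie (K.smul_mem (2 * b - a) hpq)) using 1
      simp only [generators, cons_val, x₁, smul_elt, elt_sub, elt_inj]
      grind
    · convert K.smul_mem (3 * (b - a) * q)⁻¹ (K.sub_mem hlie (K.smul_mem (2 * a - b) hpq)) using 1
      simp only [generators, cons_val, x₂, smul_elt, elt_sub, elt_inj]
      grind

theorem components_mem_of_h₁_mem (hh₁ : h₁ ∈ K) (h : elt a b c d e 0 0 0 ∈ K) :
    elt a b 0 0 0 0 0 0 ∈ K ∧ elt 0 0 c 0 0 0 0 0 ∈ K ∧ elt 0 0 0 d 0 0 0 0 ∈ K ∧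
      elt 0 0 0 0 e 0 0 0 ∈ K := by
  -- The eigenvalues of `ad h₁` on `x₁`, `x₂`, `x₃` are `2`, `-1`, `1`.
  have had : elt 0 0 (2 * c) (-d) e 0 0 0 ∈ K := by
    convert K.lie_mem hh₁ h using 1
    simp only [h₁, lie_elt, elt_inj]
    grind
  have had₂ : elt 0 0 (4 * c) d e 0 0 0 ∈ K := by
    convert K.lie_mem hh₁ had using 1
    simp only [h₁, lie_elt, elt_inj]
    grind
  have had₃ : elt 0 0 (8 * c) (-d) e 0 0 0 ∈ K := by
    convert K.lie_mem hh₁ had₂ using 1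
    simp only [h₁, lie_elt, elt_inj]
    grind
  have hc : elt 0 0 c 0 0 0 0 0 ∈ K := by
    convert K.smul_mem (1 / 6) (K.sub_mem had₃ had) using 1
    simp only [smul_elt, elt_sub, elt_inj]
    grind
  have hd : elt 0 0 0 d 0 0 0 0 ∈ K := by
    convert K.sub_mem (K.smul_mem (1 / 2) (K.sub_mem had₂ had)) hc using 1
    simp only [smul_elt, elt_sub, elt_inj]
    grind
  have he : elt 0 0 0 0 e 0 0 0 ∈ K := by
    convert K.sub_mem (K.add_mem had hd) (K.smul_mem 2 hc) using 1
    simp only [smul_elt, elt_sub, elt_add, elt_inj]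
    grind
  refine ⟨?_, hc, hd, he⟩
  simpa [elt_sub] using K.sub_mem (K.sub_mem (K.sub_mem h hc) hd) he

/-- The permutation matrix sending the first, second and third basis vectors to the third, first
and second. -/
def rotation : GL (Fin 3) ℂ :=
  ⟨!![0, 1, 0; 0, 0, 1; 1, 0, 0], !![0, 0, 1; 1, 0, 0; 0, 1, 0], by simp [one_fin_three],
    by simp [one_fin_three]⟩

theorem isListed_of_h₁_mem_of_h₂_mem (hK : Module.finrank ℂ K = 3) (hh₁ : h₁ ∈ K) (hh₂ : h₂ ∈ K)
    (h : elt 0 0 p q r 0 0 0 ∈ K) (hpqr : elt 0 0 p q r 0 0 0 ≠ 0) : IsListed K := by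
  obtain ⟨-, hp, hq, hr⟩ := components_mem_of_h₁_mem hh₁ h
  by_cases hp0 : p = 0
  · by_cases hq0 : q = 0
    · have hr0 : r ≠ 0 := fun hr0 ↦ hpqr (by rw [hp0, hq0, hr0, elt_zero])
      refine .of_map_slConj (P := swap) <| isListed_of_generators_mem
        ((finrank_map_lieEquiv K _).trans hK) .L3_zero
        (mem_map_slConj_of_mul_eq (K.smul_mem (-r⁻¹) hr) ?_)
        (mem_map_slConj_of_mul_eq (K.add_mem hh₁ hh₂) ?_)
        (mem_map_slConj_of_mul_eq (K.neg_mem hh₂) ?_)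
      all_goals simp [swap, generators, x₁, h₁, h₂, smul_elt, elt_add, coe_elt, hr0]
    · refine .of_map_slConj (P := rotation) <| isListed_of_generators_mem
        ((finrank_map_lieEquiv K _).trans hK) .L3_zero
        (mem_map_slConj_of_mul_eq (K.smul_mem q⁻¹ hq) ?_)
        (mem_map_slConj_of_mul_eq hh₂ ?_)
        (mem_map_slConj_of_mul_eq (K.neg_mem (K.add_mem hh₁ hh₂)) ?_)
      all_goals simp [rotation, generators, x₁, h₁, h₂, smul_elt, elt_add, coe_elt, hq0]
  · refine isListed_of_generators_mem hK .L3_zero ?_ hh₁ hh₂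
    simpa [generators, x₁, smul_elt, hp0] using K.smul_mem p⁻¹ hp

theorem isListed_of_elt_one_zero_mem_of_elt_zero_one_mem (hK : Module.finrank ℂ K = 3)
    (h₁₀ : elt 1 0 c d e 0 0 0 ∈ K) (h₀₁ : elt 0 1 c' d' e' 0 0 0 ∈ K)
    (h : elt 0 0 p q r 0 0 0 ∈ K) (hpqr : elt 0 0 p q r 0 0 0 ≠ 0) : IsListed K := by
  let P := GeneralLinearGroup.mkOfDetNeZero !![1, c / 2, c * d / 2 - e; 0, 1, -d; 0, 0, 1]
    (by simp [det_fin_three])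
  have hh₁ : h₁ ∈ K.map (slConj P : Alg →ₗ⁅ℂ⁆ Alg) := by
    refine mem_map_slConj_of_mul_eq h₁₀ ?_
    simp [P, GeneralLinearGroup.mkOfDetNeZero, h₁, coe_elt]
    grind
  have hh₂ : elt 0 1 (c' + c / 2) (d' + 2 * d) (e' - c * d' / 2 - c' * d - e) 0 0 0 ∈
      K.map (slConj P : Alg →ₗ⁅ℂ⁆ Alg) := by
    refine mem_map_slConj_of_mul_eq h₀₁ ?_
    simp [P, GeneralLinearGroup.mkOfDetNeZero, coe_elt]
    grind
  refine .of_map_slConj (P := P) <| isListed_of_h₁_mem_of_h₂_mem (p := p) (q := q)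
    (r := r - c * q / 2 - d * p) ((finrank_map_lieEquiv K _).trans hK) hh₁
    (components_mem_of_h₁_mem hh₁ hh₂).1 (mem_map_slConj_of_mul_eq h ?_) ?_
  · simp [P, GeneralLinearGroup.mkOfDetNeZero, coe_elt]
    grind
  · rw [← elt_zero, ne_eq, elt_inj] at hpqr ⊢
    grind

end Classification

section Triangular

variable {K : LieSubalgebra ℂ Alg} {a b c d e c' d' e' : ℂ}

theorem exists_eq_elt_of_blockTriangular {X : Alg}
    (hX : (X : Matrix (Fin 3) (Fin 3) ℂ).BlockTriangular id) :
    ∃ a b c d e : ℂ, X = elt a b c d e 0 0 0 := by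
  obtain ⟨a, b, c, d, e, c', d', e', rfl⟩ := exists_eq_elt X
  have hc' : c' = 0 := hX (i := 1) (j := 0) (by decide)
  have hd' : d' = 0 := hX (i := 2) (j := 1) (by decide)
  have he' : -e' = 0 := hX (i := 2) (j := 0) (by decide)
  exact ⟨a, b, c, d, e, elt_inj.2 (by simpa [hc', hd'] using he')⟩

/-- The coefficients of `h₁` and `h₂` in an element of `sl(3, ℂ)`. -/
def cartanCoeffs : Alg →ₗ[ℂ] Fin 2 → ℂ where
  toFun X := ![X.1 0 0, -X.1 2 2]
  map_add' X Y := by simp [add_comm]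
  map_smul' t X := by simp

theorem cartanCoeffs_elt : cartanCoeffs (elt a b c d e c' d' e') = ![a, b] := by
  simp [cartanCoeffs, coe_elt]

/-- The coefficients of the simple root vectors `x₁` and `x₂` in an element of `sl(3, ℂ)`. -/
def simpleRootCoeffs : Alg →ₗ[ℂ] Fin 2 → ℂ where
  toFun X := ![X.1 0 1, X.1 1 2]
  map_add' X Y := by simp
  map_smul' t X := by simp

theorem simpleRootCoeffs_elt : simpleRootCoeffs (elt a b c d e c' d' e') = ![c, d] := rfl

/-- The coefficient of `x₃` in an element of `sl(3, ℂ)`. -/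
def x₃Coeff : Alg →ₗ[ℂ] ℂ where
  toFun X := -X.1 0 2
  map_add' X Y := by simp [add_comm]
  map_smul' t X := by simp

theorem x₃Coeff_elt : x₃Coeff (elt a b c d e c' d' e') = e :=
  neg_neg e

/-- The elements of `K` with no component in the Cartan subalgebra spanned by `h₁` and `h₂`. -/
def cartanKer (K : LieSubalgebra ℂ Alg) : Submodule ℂ Alg :=
  K.toSubmodule ⊓ LinearMap.ker cartanCoeffs

theorem finrank_map_cartanCoeffs_add_finrank_cartanKer :
    Module.finrank ℂ (K.toSubmodule.map cartanCoeffs) + Module.finrank ℂ (cartanKer K) =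
      Module.finrank ℂ K := by
  rw [cartanKer, ← Submodule.map_comap_subtype, Submodule.finrank_map_subtype_eq,
    ← LinearMap.range_domRestrict]
  exact (cartanCoeffs.domRestrict K.toSubmodule).finrank_range_add_finrank_ker

theorem elt_mem_cartanKer : elt a b c d e c' d' e' ∈ cartanKer K ↔
    elt a b c d e c' d' e' ∈ K ∧ a = 0 ∧ b = 0 := by
  simp [cartanKer, cartanCoeffs_elt]

variable (hT : ∀ X ∈ K, (X : Matrix (Fin 3) (Fin 3) ℂ).BlockTriangular id)
include hT

theorem exists_eq_elt_of_mem_cartanKer {X : Alg} (hX : X ∈ cartanKer K) :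
    ∃ p q r, elt 0 0 p q r 0 0 0 ∈ K ∧ X = elt 0 0 p q r 0 0 0 := by
  obtain ⟨a, b, p, q, r, rfl⟩ := exists_eq_elt_of_blockTriangular (hT X hX.1)
  obtain ⟨hK, rfl, rfl⟩ := elt_mem_cartanKer.1 hX
  exact ⟨p, q, r, hK, rfl⟩

theorem x₃_mem_of_finrank_cartanKer (h : Module.finrank ℂ (cartanKer K) = 2) : x₃ ∈ K := by
  by_contra hx₃
  have hinj : Function.Injective (simpleRootCoeffs.domRestrict (cartanKer K)) := by
    rw [injective_iff_map_eq_zero]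
    rintro ⟨X, hX⟩ h0
    obtain ⟨p, q, r, hK, rfl⟩ := exists_eq_elt_of_mem_cartanKer hT hX
    obtain ⟨rfl, rfl⟩ : p = 0 ∧ q = 0 := by simpa [simpleRootCoeffs_elt] using h0
    by_contra hne
    have hr : r ≠ 0 := fun hr ↦ hne <| Subtype.ext <| by simp [hr, elt_zero]
    exact hx₃ <| by simpa [x₃, smul_elt, hr] using K.smul_mem r⁻¹ hK
  have hsurj := (LinearMap.injective_iff_surjective_of_finrank_eq_finrank (by simpa using h)).1 hinj
  obtain ⟨⟨X, hX⟩, hX'⟩ := hsurj ![1, 0]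
  obtain ⟨⟨Y, hY⟩, hY'⟩ := hsurj ![0, 1]
  obtain ⟨p, q, r, hXK, rfl⟩ := exists_eq_elt_of_mem_cartanKer hT hX
  obtain ⟨p', q', r', hYK, rfl⟩ := exists_eq_elt_of_mem_cartanKer hT hY
  obtain ⟨rfl, rfl⟩ : p = 1 ∧ q = 0 := by simpa [simpleRootCoeffs_elt] using hX'
  obtain ⟨rfl, rfl⟩ : p' = 0 ∧ q' = 1 := by simpa [simpleRootCoeffs_elt] using hY'
  exact hx₃ <| by simpa [x₃, lie_elt] using K.lie_mem hYK hXK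

theorem exists_simpleRoot_elt_mem_of_finrank_cartanKer (h : Module.finrank ℂ (cartanKer K) = 2) :
    ∃ p q, elt 0 0 p q 0 0 0 0 ∈ K ∧ (p ≠ 0 ∨ q ≠ 0) := by
  have hf : LinearMap.ker (x₃Coeff.domRestrict (cartanKer K)) ≠ ⊥ :=
    LinearMap.ker_ne_bot_of_finrank_lt (by simp [h])
  obtain ⟨⟨X, hX⟩, hX0, hne⟩ := Submodule.exists_mem_ne_zero_of_ne_bot hf
  obtain ⟨p, q, r, hK, rfl⟩ := exists_eq_elt_of_mem_cartanKer hT hX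
  obtain rfl : r = 0 := by simpa [x₃Coeff_elt] using hX0
  refine ⟨p, q, hK, ?_⟩
  contrapose! hne
  exact Subtype.ext <| by simp [hne, elt_zero]

theorem isListed_of_le_ker_cartanCoeffs (hK : Module.finrank ℂ K = 3)
    (h : K.toSubmodule ≤ LinearMap.ker cartanCoeffs) : IsListed K := by
  have hle : K.toSubmodule ≤ (subalg .L5_1).toSubmodule := fun X hX ↦ by
    obtain ⟨p, q, r, -, rfl⟩ := exists_eq_elt_of_mem_cartanKer hT ⟨hX, h hX⟩
    exact mem_subalg_iff.2 ⟨p, q, r, rfl⟩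
  obtain rfl : K = subalg .L5_1 := LieSubalgebra.toSubmodule_injective <|
    Submodule.eq_of_le_of_finrank_eq hle (hK.trans (finrank_subalg .L5_1).symm)
  exact ⟨.L5_1, .refl _⟩

theorem isListed_of_finrank_cartanKer (hK : Module.finrank ℂ K = 3)
    (h : Module.finrank ℂ (cartanKer K) = 2) (hne : K.toSubmodule.map cartanCoeffs ≠ ⊥) :
    IsListed K := by
  have hx₃ := x₃_mem_of_finrank_cartanKer hT h
  obtain ⟨p, q, hpq, hpq0⟩ := exists_simpleRoot_elt_mem_of_finrank_cartanKer hT h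
  obtain ⟨_, ⟨X, hX, rfl⟩, hX0⟩ := Submodule.exists_mem_ne_zero_of_ne_bot hne
  obtain ⟨a, b, c, d, e, rfl⟩ := exists_eq_elt_of_blockTriangular (hT X hX)
  refine isListed_of_x₃_mem (a := a) (b := b) (c := c) (d := d) hK hx₃ hpq hpq0 ?_ ?_
  · simpa [x₃, smul_elt, elt_sub] using K.sub_mem hX (K.smul_mem e hx₃)
  · contrapose! hX0
    simp [cartanCoeffs_elt, hX0]

theorem isListed_of_map_cartanCoeffs_eq_top (hK : Module.finrank ℂ K = 3)
    (htop : K.toSubmodule.map cartanCoeffs = ⊤) (hne : cartanKer K ≠ ⊥) : IsListed K := by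
  obtain ⟨X, hX, hX'⟩ := htop.ge (x := ![1, 0]) trivial
  obtain ⟨Y, hY, hY'⟩ := htop.ge (x := ![0, 1]) trivial
  obtain ⟨Z, hZ, hZ0⟩ := Submodule.exists_mem_ne_zero_of_ne_bot hne
  obtain ⟨a, b, c, d, e, rfl⟩ := exists_eq_elt_of_blockTriangular (hT X hX)
  obtain ⟨a', b', c', d', e', rfl⟩ := exists_eq_elt_of_blockTriangular (hT Y hY)
  obtain ⟨p, q, r, hZK, rfl⟩ := exists_eq_elt_of_mem_cartanKer hT hZ
  obtain ⟨rfl, rfl⟩ : a = 1 ∧ b = 0 := by simpa [cartanCoeffs_elt] using hX'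
  obtain ⟨rfl, rfl⟩ : a' = 0 ∧ b' = 1 := by simpa [cartanCoeffs_elt] using hY'
  exact isListed_of_elt_one_zero_mem_of_elt_zero_one_mem hK hX hY hZK hZ0

theorem isListed_of_blockTriangular (hK : Module.finrank ℂ K = 3) : IsListed K := by
  have hsum := finrank_map_cartanCoeffs_add_finrank_cartanKer (K := K)
  have hle : Module.finrank ℂ (K.toSubmodule.map cartanCoeffs) ≤ 2 := by
    simpa using Submodule.finrank_le (K.toSubmodule.map cartanCoeffs)
  interval_cases hr : Module.finrank ℂ (K.toSubmodule.map cartanCoeffs)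
  · exact isListed_of_le_ker_cartanCoeffs hT hK
      (LinearMap.le_ker_iff_map.2 (Submodule.finrank_eq_zero.1 hr))
  · exact isListed_of_finrank_cartanKer hT hK (by lia) (Submodule.one_le_finrank_iff.1 hr.ge)
  · exact isListed_of_map_cartanCoeffs_eq_top hT hK
      (Submodule.eq_top_of_finrank_eq (by simpa using hr))
      (Submodule.one_le_finrank_iff.1 (by lia))

end Triangular

theorem isListed_of_isSolvable {K : LieSubalgebra ℂ Alg} (hK : Module.finrank ℂ K = 3)
    [LieAlgebra.IsSolvable K] : IsListed K := by
  obtain ⟨P, hP⟩ := exists_forall_map_slConj_blockTriangular K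
  exact .of_map_slConj (isListed_of_blockTriangular hP ((finrank_map_lieEquiv K _).trans hK))

end A2

theorem mainTheorem2 :
    -- every listed subalgebra is solvable of dimension three and has the listed isomorphism type
    (∀ l : A2.Label,
      Module.finrank ℂ (A2.subalg l) = 3 ∧
      LieAlgebra.IsSolvable (A2.subalg l) ∧
      A2.HasListedType (A2.subalg l) l) ∧
    -- every three-dimensional solvable subalgebra is equivalent to a listed one
    (∀ K : LieSubalgebra ℂ A2.Alg, Module.finrank ℂ K = 3 → LieAlgebra.IsSolvable K →
      ∃ l : A2.Label, InnerEquivalent K (A2.subalg l)) ∧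
    -- distinct listed subalgebras are inequivalent, except possibly within one of the families
    (∀ l l' : A2.Label, InnerEquivalent (A2.subalg l) (A2.subalg l') →
      l = l' ∨
      (∃ α hα₁ hα₂ β hβ₁ hβ₂, l = .family₁ α hα₁ hα₂ ∧ l' = .family₁ β hβ₁ hβ₂) ∨
      (∃ α hα₁ hα₂ β hβ₁ hβ₂, l = .family₂ α hα₁ hα₂ ∧ l' = .family₂ β hβ₁ hβ₂)) ∧
    -- equivalences within the two families
    (∀ (α β : ℂ) (hα₁ : α ≠ 1) (hα₂ : α ≠ -1) (hβ₁ : β ≠ 1) (hβ₂ : β ≠ -1),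
      (InnerEquivalent (A2.subalg (.family₁ α hα₁ hα₂)) (A2.subalg (.family₁ β hβ₁ hβ₂)) ↔
        α = β ∨ α * β = 1) ∧
      (InnerEquivalent (A2.subalg (.family₂ α hα₁ hα₂)) (A2.subalg (.family₂ β hβ₁ hβ₂)) ↔
        α = β ∨ α * β = 1)) := by
  exact ⟨fun l ↦ ⟨A2.finrank_subalg l, A2.isSolvable_subalg l, A2.hasListedType_subalg l⟩,
    fun _ hK _ ↦ A2.isListed_of_isSolvable hK,
    fun _ _ ↦ A2.eq_or_family_of_innerEquivalent,
    fun _ _ _ _ _ _ ↦ ⟨A2.innerEquivalent_family₁_iff, A2.innerEquivalent_family₂_iff⟩⟩
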